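/- **Setting.** Let $\mathcal S=\mathbb C[\pi_\lambda]$ be the polynomial ring in indeterminates labelled by all partitions $\lambda$. For a $k$-tuple $L=(L_1,\dots,L_k)$ of distinct integers $\ge -k$ put $\tilde\pi_L:=\operatorname{sgn}(L)\,\pi_\lambda$, where $\operatorname{sgn}(L)$ is the sign of the permutation sorting $L$ into increasing order $L'_1<\dots<L'_k$ and $\lambda_i=L'_{k-i+1}+i$; put $\tilde\pi_L:=0$ if $L$ has repeated entries. Let $\mathcal I\subset\mathcal S$ be the ideal generated by all Plücker forms $$\sum_{j=1}^{k+1}(-1)^j\,\tilde\pi_{I_1,\dots,I_{k-1},J_j}\,\tilde\pi_{J_1,\dots,\widehat{J_j},\dots,J_{k+1}},$$ where $1\le k\le n$ and all entries of $I$ and $J$ lie in $\{-k,\dots,n-k-1\}$. A point $w$ of the infinite Grassmannian $\mathrm{Gr}_{\mathcal H_+}(\mathcal H)$ is a nonzero vector $(\pi_\lambda(w))_\lambda$ of complex numbers, up to a common scalar factor, on which every element of $\mathcal I$ vanishes (possibly infinitely many coordinates are nonzero). Its KP $\tau$-function is the formal power series $\tau_w(\mathbf t)=\sum_\lambda \pi_\lambda(w)s_\lambda(\mathbf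 t)$ in $\mathbf t=(t_1,t_2,\dots)$, where $s_\lambda=\det(h_{\lambda_i-i+j})$ and $\sum_n h_n(\mathbf t)z^n=\exp\sum_{i\ge1}t_iz^i$ (with $h_n=0$ for $n<0$). Let $x_i$ $(i\in\mathbb Z)$ be further indeterminates, $[x]:=(x,\tfrac{x^2}2,\tfrac{x^3}3,\dots)$, and let $R$ be the localization of $\mathbb C[[\mathbf x,\mathbf t]]$ at the multiplicative set generated by all $x_i-x_j$, $i\ne j$. For a finitely supported integer sequence $\mathbf n=(n_i)_{i\in\mathbb Z}$ set $$H^{\mathbf n}_w:=\prod_{i<j}(x_i-x_j)^{n_in_j}\;\tau_w\Big(\mathbf t+\sum_{i}n_i[x_i]\Big)\in R,\qquad H^{\mathbf n,(p|q)}_w:=H_w^{\mathbf n+\boldsymbol\alpha_p-\boldsymbol\alpha_{-q-1}}\quad(p,q\ge0),$$ where $\boldsymbol\alpha_i$ is the sequence with $1$ in position $i$ and $0$ elsewhere. Let $\boldsymbol\beta_i:=\boldsymbol\alpha_{i-1}-\boldsymbol\alpha_{-i}$ for $i\ge 1$ and $\mathbf B_3:=\mathrm{span}_{\mathbb Z}\{\boldsymbol\beta_1,\boldsymbol\beta_2,\boldsymbol\beta_3\}$.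 For $\mathbf n'=n'_1\boldsymbol\beta_1+n'_2\boldsymbol\beta_2+n'_3\boldsymbol\beta_3\in\mathbf B_3$ define elements of $R$ $$\begin{aligned} \check H^{\mathbf n'}&:=(-1)^{n'_1+n'_2+n'_3+n'_1n'_2+n'_1n'_3+n'_2n'_3}H_w^{\mathbf n'},\\ \check H^{\mathbf n',(x)}&:=(-1)^{(n'_1)^2+n'_2n'_3+(n'_3)^2}H_w^{\mathbf n',(1|2)},&\check H^{\mathbf n',(-x)}&:=(-1)^{(n'_1)^2+n'_2n'_3+(n'_3)^2}H_w^{\mathbf n',(2|1)},\\ \check H^{\mathbf n',(y)}&:=(-1)^{n'_1n'_3+(n'_3)^2}H_w^{\mathbf n',(2|0)},&\check H^{\mathbf n',(-y)}&:=(-1)^{n'_1n'_3+(n'_3)^2}H_w^{\mathbf n',(0|2)},\\ \check H^{\mathbf n',(z)}&:=(-1)^{n'_1n'_2+(n'_2)^2+(n'_3)^2}H_w^{\mathbf n',(0|1)},&\check H^{\mathbf n',(-z)}&:=(-1)^{n'_1n'_2+(n'_2)^2+(n'_3)^2}H_w^{\mathbf n',(1|0)}. \end{aligned}$$ For $\mathbf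 v'\in\mathbf B_3$ let $\check H_{\mathbf v'}$, $\check H^{(\cdot)}_{\mathbf v'}$ denote the functions $\mathbf n'\mapsto\check H^{\mathbf n'+\mathbf v'}$, $\mathbf n'\mapsto\check H^{\mathbf n'+\mathbf v',(\cdot)}$ on $\mathbf B_3$. **Corollary.** For every $w\in\mathrm{Gr}_{\mathcal H_+}(\mathcal H)$ (and every choice of its homogeneous coordinates) these functions satisfy, at every point of $\mathbf B_3$, $$\begin{aligned} \check H\check H^{(x)}\check H^{(-x)}_{\boldsymbol\beta_1}&=\check H\check H_{\boldsymbol\beta_1}\check H_{\boldsymbol\beta_2+\boldsymbol\beta_3}+\check H_{\boldsymbol\beta_1}\check H_{\boldsymbol\beta_2}\check H_{\boldsymbol\beta_3}+\check H^{(x)}\check H^{(y)}\check H^{(z)},\\ \check H\check H^{(y)}\check H^{(-y)}_{\boldsymbol\beta_2}&=\check H\check H_{\boldsymbol\beta_2}\check H_{\boldsymbol\beta_1+\boldsymbol\beta_3}+\check H_{\boldsymbol\beta_1}\check H_{\boldsymbol\beta_2}\check H_{\boldsymbol\beta_3}+\check H^{(x)}\check H^{(y)}\check H^{(z)},\\ \check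 H\check H^{(z)}\check H^{(-z)}_{\boldsymbol\beta_3}&=\check H\check H_{\boldsymbol\beta_3}\check H_{\boldsymbol\beta_1+\boldsymbol\beta_2}+\check H_{\boldsymbol\beta_1}\check H_{\boldsymbol\beta_2}\check H_{\boldsymbol\beta_3}+\check H^{(x)}\check H^{(y)}\check H^{(z)},\\ \check H\check H^{(-x)}\check H^{(x)}_{\boldsymbol\beta_1}&=\check H\check H_{\boldsymbol\beta_1}\check H_{\boldsymbol\beta_2+\boldsymbol\beta_3}+\check H_{\boldsymbol\beta_1}\check H_{\boldsymbol\beta_2}\check H_{\boldsymbol\beta_3}+\check H^{(-x)}\check H^{(-y)}\check H^{(-z)},\\ \check H\check H^{(-y)}\check H^{(y)}_{\boldsymbol\beta_2}&=\check H\check H_{\boldsymbol\beta_2}\check H_{\boldsymbol\beta_1+\boldsymbol\beta_3}+\check H_{\boldsymbol\beta_1}\check H_{\boldsymbol\beta_2}\check H_{\boldsymbol\beta_3}+\check H^{(-x)}\check H^{(-y)}\check H^{(-z)},\\ \check H\check H^{(-z)}\check H^{(z)}_{\boldsymbol\beta_3}&=\check H\check H_{\boldsymbol\beta_3}\check H_{\boldsymbol\beta_1+\boldsymbol\beta_2}+\check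 H_{\boldsymbol\beta_1}\check H_{\boldsymbol\beta_2}\check H_{\boldsymbol\beta_3}+\check H^{(-x)}\check H^{(-y)}\check H^{(-z)},\\ \check H^2\check H^{(x)}\check H^{(y)}\check H^{(z)}\check H_{\boldsymbol\beta_1+\boldsymbol\beta_2+\boldsymbol\beta_3}&=(\check H^{(x)}\check H^{(y)}\check H^{(z)})^2+\check H^{(x)}\check H^{(y)}\check H^{(z)}\Big(2\check H_{\boldsymbol\beta_1}\check H_{\boldsymbol\beta_2}\check H_{\boldsymbol\beta_3}\\ &\quad+\check H\big(\check H_{\boldsymbol\beta_1}\check H_{\boldsymbol\beta_2+\boldsymbol\beta_3}+\check H_{\boldsymbol\beta_2}\check H_{\boldsymbol\beta_1+\boldsymbol\beta_3}+\check H_{\boldsymbol\beta_3}\check H_{\boldsymbol\beta_1+\boldsymbol\beta_2}\big)\Big)\\ &\quad+(\check H_{\boldsymbol\beta_1}\check H_{\boldsymbol\beta_2}+\check H\check H_{\boldsymbol\beta_1+\boldsymbol\beta_2})(\check H_{\boldsymbol\beta_1}\check H_{\boldsymbol\beta_3}+\check H\check H_{\boldsymbol\beta_1+\boldsymbol\beta_3})(\check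 H_{\boldsymbol\beta_2}\check H_{\boldsymbol\beta_3}+\check H\check H_{\boldsymbol\beta_2+\boldsymbol\beta_3}). \end{aligned}$$ -/

import Mathlib

open scoped LinearAlgebra.Projectivization

namespace KPLattice

noncomputable section

/-! ### Plücker relations and the infinite Grassmannian -/

/-- The partition attached to a strictly increasing `k`-tuple `L` of integers `≥ -k`: with
one-based indices, `λ_i = L_{k-i+1} + i` for `i = 1, …, k`. -/
def partitionOfTuple {k : ℕ} (L : Fin k → ℤ) (hL : StrictMono L) : YoungDiagram :=
  YoungDiagram.ofRowLens (List.ofFn fun i : Fin k => (L (Fin.rev i) + (i : ℤ) + 1).toNat) (by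
    rw [List.sortedGE_ofFn_iff]
    intro a b hab
    rcases eq_or_lt_of_le hab with rfl | hab
    · exact le_rfl
    · have key : ∀ d : ℕ, ∀ a b : Fin k, (b : ℕ) = a + d →
          L (Fin.rev b) + (b : ℤ) ≤ L (Fin.rev a) + (a : ℤ) := by
        intro d
        induction d with
        | zero =>
          intro a b h
          have : b = a := Fin.ext (by simpa using h)
          rw [this]
        | succ d ih =>
          intro a b h
          have hb : (a : ℕ) + d < k := by have := b.isLt; omega
          have h1 := ih a ⟨a + d, hb⟩ rfl
          have h2 : L (Fin.rev b) < L (Fin.rev ⟨a + d, hb⟩) := by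
            apply hL
            rw [Fin.rev_lt_rev, Fin.lt_def]
            simp only
            omega
          simp only at h1
          push_cast at h1
          have h3 : (b : ℤ) = a + d + 1 := by exact_mod_cast h
          linarith
      have hab' : (a : ℕ) < b := hab
      have := key ((b : ℕ) - a) a b (by omega)
      apply Int.toNat_le_toNat
      linarith)

/-- The polynomial ring `𝒮 = ℂ[π_λ]` in indeterminates labelled by all partitions. -/
abbrev PluckerRing : Type := MvPolynomial YoungDiagram ℂ

open Classical in
/-- The skew-symmetric symbol `π̃_L` for an arbitrary `k`-tuple `L`: it is `sgn(L) π_λ`, where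
`sgn(L)` is the sign of the permutation that sorts `L` increasingly and `λ` is the partition of
the sorted tuple; it is `0` if `L` has a repeated entry. -/
def piTilde {k : ℕ} (L : Fin k → ℤ) : PluckerRing :=
  if h : Function.Injective L then
    ((Equiv.Perm.sign (Tuple.sort L) : ℤ) : PluckerRing) *
      MvPolynomial.X (partitionOfTuple (L ∘ Tuple.sort L)
        ((Tuple.monotone_sort L).strictMono_of_injective (h.comp (Tuple.sort L).injective)))
  else 0

/-- The Plücker quadratic form
`p_{I,J} = ∑_{j=1}^{k+1} (-1)^j π̃_{I_1,…,I_{k-1},J_j} π̃_{J_1,…,Ĵ_j,…,J_{k+1}}`, where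
`k = m + 1`. -/
def pluckerForm {m : ℕ} (I : Fin m → ℤ) (J : Fin (m + 2) → ℤ) : PluckerRing :=
  ∑ j : Fin (m + 2), (-1) ^ ((j : ℕ) + 1) *
    (piTilde (Fin.snoc I (J j) : Fin (m + 1) → ℤ) * piTilde (fun i : Fin (m + 1) => J (j.succAbove i)))

/-- The Plücker forms of the Grassmannian of `k`-dimensional subspaces of the `n`-dimensional
space with basis `e_{-k}, …, e_{n-k-1}` (none for `k = 0`). -/
def pluckerForms (k n : ℕ) : Set PluckerRing :=
  {p | ∃ (m : ℕ) (I : Fin m → ℤ) (J : Fin (m + 2) → ℤ), k = m + 1 ∧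
    (∀ a, -(k : ℤ) ≤ I a ∧ I a ≤ (n : ℤ) - k - 1) ∧
    (∀ a, -(k : ℤ) ≤ J a ∧ J a ≤ (n : ℤ) - k - 1) ∧ p = pluckerForm I J}

/-- The ideal `ℐ ⊂ 𝒮` generated by the Plücker relations of all finite Grassmannians
`0 ≤ k ≤ n`. -/
def pluckerIdeal : Ideal PluckerRing :=
  Ideal.span {p | ∃ k n : ℕ, k ≤ n ∧ p ∈ pluckerForms k n}

/-- The (closed points of the) infinite Grassmannian `Gr_{ℋ₊}(ℋ) = Proj (𝒮 / ℐ)`: the lines of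
coordinate vectors `(π_λ)_λ`, with possibly infinitely many nonzero entries, on which all
elements of `ℐ` vanish. -/
def infiniteGrassmannian : Set (ℙ ℂ (YoungDiagram → ℂ)) :=
  {w | ∀ (v : YoungDiagram → ℂ) (hv : v ≠ 0), Projectivization.mk ℂ v hv = w →
    ∀ f ∈ pluckerIdeal, MvPolynomial.eval v f = 0}

/-! ### Schur functions and the KP `τ`-function -/

/-- The weight `∑ i m_i` of the monomial `∏ t_i ^ {m_i}`. -/
def tWeight (m : ℕ+ →₀ ℕ) : ℕ := m.sum fun i a => (i : ℕ) * a

/-- The complete homogeneous symmetric functions `h_n(t)`, `n ∈ ℤ`, as functions of the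
normalized power sums `t_i = p_i / i`: `∑ h_n(t) z^n = exp (∑_{i ≥ 1} t_i z^i)`, that is,
`h_n(t) = ∑_{∑ i m_i = n} ∏ t_i ^ {m_i} / m_i!` (so `h_0 = 1` and `h_n = 0` for `n < 0`). -/
def completeH (n : ℤ) : MvPowerSeries ℕ+ ℂ :=
  fun m => if (tWeight m : ℤ) = n then m.prod fun _ a => ((a.factorial : ℂ))⁻¹ else 0

/-- The Schur function `s_λ(t) = det (h_{λ_i - i + j}(t))_{1 ≤ i, j ≤ ℓ(λ)}`. -/
def schur (μ : YoungDiagram) : MvPowerSeries ℕ+ ℂ :=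
  Matrix.det (Matrix.of fun i j : Fin (μ.colLen 0) =>
    completeH ((μ.rowLen i : ℤ) - (i : ℤ) + (j : ℤ)))

/-- The KP `τ`-function `τ(t) = ∑_λ π_λ s_λ(t)` with Plücker coordinates `π_λ = v λ`, as a formal
power series in `t`; for every monomial only finitely many `λ` contribute to its coefficient
(see `finite_support_tau`). -/
def tau (v : YoungDiagram → ℂ) : MvPowerSeries ℕ+ ℂ :=
  fun m => ∑ᶠ μ : YoungDiagram, v μ * MvPowerSeries.coeff m (schur μ)

/-! ### Evaluation of the `τ`-function on a lattice -/

/-- `ℂ[[x, t]]`, with variables `x_i` (`i ∈ ℤ`) and `t_j` (`j ≥ 1`). -/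
abbrev XTSeries : Type := MvPowerSeries (ℤ ⊕ ℕ+) ℂ

/-- The variable `x_i`. -/
def xVar (i : ℤ) : XTSeries := MvPowerSeries.X (Sum.inl i)

/-- The variable `t_j`. -/
def tVar (j : ℕ+) : XTSeries := MvPowerSeries.X (Sum.inr j)

/-- The multiplicative set generated by the differences `x_i - x_j`, `i ≠ j`. -/
def diffSubmonoid : Submonoid XTSeries :=
  Submonoid.closure {f | ∃ i j : ℤ, i ≠ j ∧ f = xVar i - xVar j}

/-- The localization of `ℂ[[x, t]]` at all `x_i - x_j`, `i ≠ j`. -/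
abbrev XTLoc : Type := Localization diffSubmonoid

/-- The lattice `𝐀` of integer sequences indexed by `ℤ` with finitely many nonzero entries. -/
abbrev LatticeA : Type := ℤ →₀ ℤ

/-- The basis element `α_i` of `𝐀`. -/
def alpha (i : ℤ) : LatticeA := Finsupp.single i 1

/-- `x_i - x_j` as a unit of the localized ring (and `1` if `i = j`). -/
def diffUnit (i j : ℤ) : XTLocˣ :=
  if h : i = j then 1 else
    (IsLocalization.map_units XTLoc
      (⟨xVar i - xVar j, Submonoid.subset_closure ⟨i, j, h, rfl⟩⟩ : diffSubmonoid)).unit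

/-- The normalization factor `∏_{i < j} (x_i - x_j) ^ {n_i n_j}`. -/
def vandermonde (n : LatticeA) : XTLocˣ :=
  ∏ i ∈ n.support, ∏ j ∈ n.support with i < j, diffUnit i j ^ (n i * n j)

/-- The shifted variables `t + ∑_i n_i [x_i]`, where `[x] = (x, x²/2, x³/3, …)`. -/
def shiftedT (n : LatticeA) (j : ℕ+) : XTSeries :=
  tVar j + ∑ i ∈ n.support, MvPowerSeries.C ((n i : ℂ) / (j : ℂ)) * xVar i ^ (j : ℕ)

/-- The normalized lattice evaluation
`H^n = ∏_{i < j} (x_i - x_j) ^ {n_i n_j} τ(t + ∑_i n_i [x_i])`. -/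
def latticeEval (v : YoungDiagram → ℂ) (n : LatticeA) : XTLoc :=
  (vandermonde n : XTLoc) * algebraMap XTSeries XTLoc (MvPowerSeries.subst (shiftedT n) (tau v))

/-- `H^{n, λ} = H^{n + ∑ α_{a_i} - ∑ α_{-b_i-1}}` for the partition `λ = (a_1,…,a_r | b_1,…,b_r)` in
Frobenius notation. -/
def latticeEvalFrob (v : YoungDiagram → ℂ) (n : LatticeA) {r : ℕ} (a b : Fin r → ℕ) : XTLoc :=
  latticeEval v (n + ∑ i, alpha (a i) - ∑ i, alpha (-(b i : ℤ) - 1))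

/-! ### The three-dimensional sublattice and the sign-twisted evaluations -/

/-- `β_i = α_{i-1} - α_{-i}`, `i ≥ 1`. -/
def beta (i : ℕ+) : LatticeA := alpha ((i : ℤ) - 1) - alpha (-(i : ℤ))

/-- `𝐁₃`, the span of `β_1, β_2, β_3`. -/
def latticeB3 : AddSubgroup LatticeA := AddSubgroup.closure {beta 1, beta 2, beta 3}

/-- `β_1` as an element of `𝐁₃`. -/
def b₁ : latticeB3 := ⟨beta 1, AddSubgroup.subset_closure (by simp)⟩

/-- `β_2` as an element of `𝐁₃`. -/
def b₂ : latticeB3 := ⟨beta 2, AddSubgroup.subset_closure (by simp)⟩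

/-- `β_3` as an element of `𝐁₃`. -/
def b₃ : latticeB3 := ⟨beta 3, AddSubgroup.subset_closure (by simp)⟩

/-- The coordinate of `n` along `β_i`, for `n` in the span of the `β`'s (see
`eq_sum_betaCoord`). -/
def betaCoord (i : ℕ+) (n : latticeB3) : ℤ := (n : LatticeA) ((i : ℤ) - 1)

/-- `(-1) ^ e` in the localized ring, for an integer `e`. -/
def negOnePow (e : ℤ) : XTLoc := ((-1 : XTLocˣ) ^ e : XTLocˣ)

/-- `Ȟ`. -/
def checkH (v : YoungDiagram → ℂ) (n : latticeB3) : XTLoc :=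
  let n₁ := betaCoord 1 n; let n₂ := betaCoord 2 n; let n₃ := betaCoord 3 n
  negOnePow (n₁ + n₂ + n₃ + n₁ * n₂ + n₁ * n₃ + n₂ * n₃) * latticeEval v n

/-- The sign of `Ȟ^{(±x)}`. -/
def signX (n : latticeB3) : XTLoc :=
  negOnePow (betaCoord 1 n ^ 2 + betaCoord 2 n * betaCoord 3 n + betaCoord 3 n ^ 2)

/-- The sign of `Ȟ^{(±y)}`. -/
def signY (n : latticeB3) : XTLoc :=
  negOnePow (betaCoord 1 n * betaCoord 3 n + betaCoord 3 n ^ 2)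

/-- The sign of `Ȟ^{(±z)}`. -/
def signZ (n : latticeB3) : XTLoc :=
  negOnePow (betaCoord 1 n * betaCoord 2 n + betaCoord 2 n ^ 2 + betaCoord 3 n ^ 2)

/-- `Ȟ^{(x)}`. -/
def checkX (v : YoungDiagram → ℂ) (n : latticeB3) : XTLoc :=
  signX n * latticeEvalFrob v n ![1] ![2]

/-- `Ȟ^{(-x)}`. -/
def checkNegX (v : YoungDiagram → ℂ) (n : latticeB3) : XTLoc :=
  signX n * latticeEvalFrob v n ![2] ![1]

/-- `Ȟ^{(y)}`. -/
def checkY (v : YoungDiagram → ℂ) (n : latticeB3) : XTLoc :=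
  signY n * latticeEvalFrob v n ![2] ![0]

/-- `Ȟ^{(-y)}`. -/
def checkNegY (v : YoungDiagram → ℂ) (n : latticeB3) : XTLoc :=
  signY n * latticeEvalFrob v n ![0] ![2]

/-- `Ȟ^{(z)}`. -/
def checkZ (v : YoungDiagram → ℂ) (n : latticeB3) : XTLoc :=
  signZ n * latticeEvalFrob v n ![0] ![1]

/-- `Ȟ^{(-z)}`. -/
def checkNegZ (v : YoungDiagram → ℂ) (n : latticeB3) : XTLoc :=
  signZ n * latticeEvalFrob v n ![1] ![0]

/-- The doubled hexahedron recurrence system, with all coefficients positive, for seven functions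
on `𝐁₃` (`X'`, `Y'`, `Z'` are the functions labelled `-x`, `-y`, `-z`). -/
def IsDoubledHexahedronSolution {R : Type} [CommRing R]
    (H X Y Z X' Y' Z' : latticeB3 → R) : Prop :=
  ∀ n : latticeB3,
    H n * X n * X' (n + b₁) =
      H n * H (n + b₁) * H (n + (b₂ + b₃)) + H (n + b₁) * H (n + b₂) * H (n + b₃)
        + X n * Y n * Z n ∧
    H n * Y n * Y' (n + b₂) =
      H n * H (n + b₂) * H (n + (b₁ + b₃)) + H (n + b₁) * H (n + b₂) * H (n + b₃)
        + X n * Y n * Z n ∧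
    H n * Z n * Z' (n + b₃) =
      H n * H (n + b₃) * H (n + (b₁ + b₂)) + H (n + b₁) * H (n + b₂) * H (n + b₃)
        + X n * Y n * Z n ∧
    H n * X' n * X (n + b₁) =
      H n * H (n + b₁) * H (n + (b₂ + b₃)) + H (n + b₁) * H (n + b₂) * H (n + b₃)
        + X' n * Y' n * Z' n ∧
    H n * Y' n * Y (n + b₂) =
      H n * H (n + b₂) * H (n + (b₁ + b₃)) + H (n + b₁) * H (n + b₂) * H (n + b₃)
        + X' n * Y' n * Z' n ∧
    H n * Z' n * Z (n + b₃) =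
      H n * H (n + b₃) * H (n + (b₁ + b₂)) + H (n + b₁) * H (n + b₂) * H (n + b₃)
        + X' n * Y' n * Z' n ∧
    H n ^ 2 * X n * Y n * Z n * H (n + (b₁ + b₂ + b₃)) =
      (X n * Y n * Z n) ^ 2
        + (X n * Y n * Z n) *
          (2 * H (n + b₁) * H (n + b₂) * H (n + b₃)
            + H n * (H (n + b₁) * H (n + (b₂ + b₃)) + H (n + b₂) * H (n + (b₁ + b₃))
              + H (n + b₃) * H (n + (b₁ + b₂))))
        + (H (n + b₁) * H (n + b₂) + H n * H (n + (b₁ + b₂)))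
          * (H (n + b₁) * H (n + b₃) + H n * H (n + (b₁ + b₃)))
          * (H (n + b₂) * H (n + b₃) + H n * H (n + (b₂ + b₃)))

/-! ### The definitions above are not junk values -/

lemma coe_diffUnit {i j : ℤ} (h : i ≠ j) :
    (diffUnit i j : XTLoc) = algebraMap XTSeries XTLoc (xVar i - xVar j) := by
  simp [diffUnit, h]

lemma eq_sum_betaCoord (n : latticeB3) :
    n = betaCoord 1 n • b₁ + betaCoord 2 n • b₂ + betaCoord 3 n • b₃ := by
  obtain ⟨n, hn⟩ := n
  apply Subtype.ext
  simp only [betaCoord, b₁, b₂, b₃, AddSubgroup.coe_add, AddSubgroup.coe_zsmul]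
  induction hn using AddSubgroup.closure_induction with
  | mem x hx =>
    rcases hx with rfl | rfl | rfl <;> simp [beta, alpha]
  | zero => simp
  | add x y _ _ hx hy =>
    conv_lhs => rw [hx, hy]
    simp only [Finsupp.add_apply, add_smul]
    abel
  | neg x _ hx =>
    conv_lhs => rw [hx]
    simp only [Finsupp.neg_apply, neg_smul]
    abel

lemma hasSubst_shiftedT (n : LatticeA) : MvPowerSeries.HasSubst (shiftedT n) := by
  classical
  constructor
  · intro j
    have : MvPowerSeries.constantCoeff (shiftedT n j) = 0 := by
      simp [shiftedT, tVar, xVar]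
    rw [this]
    exact IsNilpotent.zero
  · intro d
    -- The monomials of the `j`-th series are `t_j` and `x_i ^ j`, so `j` can be read off `d`.
    set g : (ℤ ⊕ ℕ+ →₀ ℕ) → Set ℕ := fun d =>
      ((d.support.image fun s => Sum.elim (fun i => d (Sum.inl i)) (fun j : ℕ+ => (j : ℕ)) s : Finset ℕ) :
        Set ℕ) with hg
    have hfin : ((fun j : ℕ+ => (j : ℕ)) ⁻¹' g d).Finite :=
      (Finset.finite_toSet _).preimage (PNat.coe_injective.injOn)
    refine hfin.subset fun j hj => ?_
    by_contra hcon
    apply hj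
    have hmem : ∀ s ∈ d.support,
        Sum.elim (fun i => d (Sum.inl i)) (fun j : ℕ+ => (j : ℕ)) s ≠ (j : ℕ) := by
      intro s hs h
      apply hcon
      simp only [hg, Set.mem_preimage, Finset.coe_image, Set.mem_image]
      exact ⟨s, hs, h⟩
    have ht : MvPowerSeries.coeff d (tVar j) = 0 := by
      rw [tVar, MvPowerSeries.coeff_X, if_neg]
      rintro rfl
      exact hmem (Sum.inr j) (by simp) rfl
    have hx : ∀ i, MvPowerSeries.coeff d (xVar i ^ (j : ℕ)) = 0 := by
      intro i
      rw [xVar, MvPowerSeries.coeff_X_pow, if_neg]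
      rintro rfl
      exact hmem (Sum.inl i) (by simp) (by simp)
    simp [shiftedT, ht, hx]

lemma coeff_completeH_ne_zero {n : ℤ} {m : ℕ+ →₀ ℕ}
    (h : MvPowerSeries.coeff m (completeH n) ≠ 0) : (tWeight m : ℤ) = n := by
  by_contra hn
  apply h
  change (if (tWeight m : ℤ) = n then _ else _) = _
  rw [if_neg hn]

lemma tWeight_add (m m' : ℕ+ →₀ ℕ) : tWeight (m + m') = tWeight m + tWeight m' :=
  Finsupp.sum_add_index' (fun _ => by simp) (fun _ _ _ => by ring)

lemma coeff_prod_completeH_ne_zero {ι : Type} (s : Finset ι) (d : ι → ℤ) :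
    ∀ m : ℕ+ →₀ ℕ, MvPowerSeries.coeff m (∏ i ∈ s, completeH (d i)) ≠ 0 →
      (tWeight m : ℤ) = ∑ i ∈ s, d i := by
  classical
  induction s using Finset.induction_on with
  | empty =>
    intro m h
    rw [Finset.prod_empty, MvPowerSeries.coeff_one] at h
    have : m = 0 := by
      by_contra hm
      exact h (if_neg hm)
    simp [this, tWeight]
  | insert a s ha ih =>
    intro m h
    rw [Finset.prod_insert ha, MvPowerSeries.coeff_mul] at h
    obtain ⟨⟨p, q⟩, hpq, hne⟩ := Finset.exists_ne_zero_of_sum_ne_zero h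
    rw [Finset.HasAntidiagonal.mem_antidiagonal] at hpq
    rw [Finset.sum_insert ha, ← coeff_completeH_ne_zero (left_ne_zero_of_mul hne),
      ← ih q (right_ne_zero_of_mul hne), ← hpq, tWeight_add]
    push_cast
    rfl

/-- `s_λ` is homogeneous of weighted degree `|λ|`. -/
lemma coeff_schur_ne_zero {μ : YoungDiagram} {m : ℕ+ →₀ ℕ}
    (h : MvPowerSeries.coeff m (schur μ) ≠ 0) :
    tWeight m = ∑ i : Fin (μ.colLen 0), μ.rowLen i := by
  rw [schur, Matrix.det_apply, map_sum] at h
  obtain ⟨σ, -, hσ⟩ := Finset.exists_ne_zero_of_sum_ne_zero h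
  have h' : MvPowerSeries.coeff m (∏ i : Fin (μ.colLen 0),
      completeH ((μ.rowLen (σ i) : ℤ) - ((σ i : Fin _) : ℤ) + ((i : Fin _) : ℤ))) ≠ 0 := by
    intro h0
    apply hσ
    have h1 : (Equiv.Perm.sign σ : ℤˣ) • (∏ i : Fin (μ.colLen 0),
      completeH ((μ.rowLen (σ i) : ℤ) - ((σ i : Fin _) : ℤ) + ((i : Fin _) : ℤ))) =
      ((Equiv.Perm.sign σ : ℤˣ) : ℤ) • (∏ i : Fin (μ.colLen 0),
      completeH ((μ.rowLen (σ i) : ℤ) - ((σ i : Fin _) : ℤ) + ((i : Fin _) : ℤ))) := rfl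
    simp only [Matrix.of_apply]
    rw [h1, map_zsmul, h0, smul_zero]
  have h2 := coeff_prod_completeH_ne_zero _ _ m h'
  rw [Finset.sum_add_distrib, Finset.sum_sub_distrib,
    Equiv.sum_comp σ (fun i => (μ.rowLen i : ℤ)),
    Equiv.sum_comp σ (fun i : Fin (μ.colLen 0) => ((i : ℕ) : ℤ))] at h2
  have h3 : (tWeight m : ℤ) = ∑ i : Fin (μ.colLen 0), (μ.rowLen i : ℤ) := by linarith
  exact_mod_cast h3

lemma finite_support_tau (v : YoungDiagram → ℂ) (m : ℕ+ →₀ ℕ) :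
    (Function.support fun μ : YoungDiagram =>
      v μ * MvPowerSeries.coeff m (schur μ)).Finite := by
  classical
  have hinj : Function.Injective (fun μ : YoungDiagram => μ.cells) := fun _ _ h =>
    YoungDiagram.ext h
  have hfin : (((Finset.range (tWeight m + 1) ×ˢ Finset.range (tWeight m + 1)).powerset :
      Finset (Finset (ℕ × ℕ))) : Set (Finset (ℕ × ℕ))).Finite := Finset.finite_toSet _
  refine (hfin.preimage hinj.injOn).subset fun μ hμ => ?_
  have hw := coeff_schur_ne_zero (right_ne_zero_of_mul hμ)
  simp only [Set.mem_preimage, Finset.mem_coe, Finset.mem_powerset]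
  rintro ⟨i, j⟩ hij
  rw [YoungDiagram.mem_cells] at hij
  have hi : i < μ.colLen 0 :=
    YoungDiagram.mem_iff_lt_colLen.1 (μ.up_left_mem le_rfl (Nat.zero_le _) hij)
  have hj : j < μ.rowLen i := YoungDiagram.mem_iff_lt_rowLen.1 hij
  have hlen : μ.colLen 0 ≤ tWeight m := by
    rw [hw]
    calc μ.colLen 0 = ∑ _i : Fin (μ.colLen 0), 1 := by simp
      _ ≤ _ := Finset.sum_le_sum fun a _ => by
        have := YoungDiagram.mem_iff_lt_colLen.2 a.isLt
        have := YoungDiagram.mem_iff_lt_rowLen.1 this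
        omega
  have hrow : μ.rowLen i ≤ tWeight m := by
    rw [hw]
    exact Finset.single_le_sum (f := fun a : Fin (μ.colLen 0) => μ.rowLen a)
      (fun _ _ => Nat.zero_le _) (Finset.mem_univ ⟨i, hi⟩)
  simp only [Finset.mem_product, Finset.mem_range]
  omega

end

end KPLattice

namespace KPLattice

noncomputable section

/-! ### Alternating maps on almost triangular families -/

section Alternating

variable {A V : Type*} [CommRing A] [AddCommGroup V] [Module A V]

/-! Put N = n + α_0 + α_1 + α_2. The twenty evaluations in the recurrences sit at the points N - α_i
- α_j - α_l with -3 ≤ i < j < l ≤ 2; adding β_1, β_2, β_3 trades the index 0 for -1, 1 for -2, 2 for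
-3. As functions of (i, j, l) these values satisfy the Plücker relations of Gr(3, 6), and the
recurrences are polynomial consequences of those relations (`hexahedron`). The signs in Ȟ only make
the coefficients positive.

The Plücker relations in (i, j, l) come from those of w. By Jacobi–Trudi, the part of τ supported on
partitions in the k × k square is an alternating form with coefficients π_λ, evaluated at the
consecutive vectors u_1, …, u_k with u_j = (h_{L+j})_L (`seqEval_boxForm`). Replacing t by t - [x]
multiplies ∑ h_n z^n by 1 - xz, so u_j becomes u_j - x u_{j-1} (`latticeH_sub_alpha`). The form
satisfies the Plücker relations on arbitrary vectors (`isPlucker_boxForm`). For well-chosen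
differences of u all but four terms vanish, and 3 × 3 determinants turn these four into products of
differences of the x's with shifted values of the form: a Fay identity (`fay_seqEval`).

Each coefficient stabilises as k grows, so the identity passes to τ (`fay_latticeTau`). The
normalisation of H^n is multiplicatively quadratic in n; it supplies exactly the Vandermonde factor
that makes the values alternating in (i, j, l) and absorbs the coefficients of the Fay identity
(`isPlucker₃_fayCoord`). -/

lemma alternatingMap_linearCombination {k : ℕ} (P : V [⋀^Fin k]→ₗ[A] A)
    (M : Fin k → Fin k → A) (w : Fin k → V) :
    P (fun i => Fintype.linearCombination A w (M i)) = (Matrix.of M).det * P w := by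
  -- Pulled back to A^k along the linear combination map, P becomes a top-degree alternating form,
  -- hence a multiple of the determinant.
  have h := AlternatingMap.eq_smul_basis_det (Pi.basisFun A (Fin k))
    (P.compLinearMap (Fintype.linearCombination A w))
  have h2 := congrArg (fun Q => Q M) h
  simp only [AlternatingMap.compLinearMap_apply, AlternatingMap.smul_apply, smul_eq_mul] at h2
  rw [mul_comm]
  have e : (Pi.basisFun A (Fin k)).det M = (Matrix.of M).det := by
    rw [Pi.basisFun_det]; rfl
  rw [← e]
  convert h2 using 3
  simp

/-- The matrix is block lower triangular with a unitriangular lower block; expanding along the last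
column removes one row and column at a time. -/
lemma det_eq_det_three {m : ℕ} (M : Matrix (Fin (m + 3)) (Fin (m + 3)) A)
    (h0 : ∀ i j : Fin (m + 3), 3 ≤ (j : ℕ) → i < j → M i j = 0)
    (h1 : ∀ i : Fin (m + 3), 3 ≤ (i : ℕ) → M i i = 1) :
    M.det = (M.submatrix (Fin.castLE (Nat.le_add_left 3 m))
      (Fin.castLE (Nat.le_add_left 3 m))).det := by
  induction m with
  | zero => rfl
  | succ m ih =>
    rw [Matrix.det_succ_column M (Fin.last _), Finset.sum_eq_single (Fin.last _)]
    · rw [h1 _ (by simp), ih]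
      · simp only [Fin.succAbove_last, Matrix.submatrix_submatrix, ← two_mul, pow_mul]
        simp
        rfl
      · intro i j hj hij
        simpa using h0 i.castSucc j.castSucc hj hij
      · intro i hi
        simpa using h1 i.castSucc hi
    · intro i _ hi
      rw [h0 i _ (by simp) (Fin.lt_last_iff_ne_last.2 hi)]
      simp
    · simp

/-- Replacing the tail of a family by the tail of a unitriangular combination, and its head by
combinations of the head, multiplies an alternating map by the determinant of the head. -/
lemma alternatingMap_head {m : ℕ} (P : V [⋀^Fin (m + 3)]→ₗ[A] A) (x w : ℕ → V)
    (N : Matrix (Fin 3) (Fin 3) A) (a b c : A)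
    (hx : ∀ i : Fin 3, x i = ∑ j : Fin 3, N i j • w j)
    (hx' : ∀ i, x (i + 3) = w (i + 3) + a • w (i + 2) + b • w (i + 1) + c • w i) :
    P (fun i => x i) = N.det * P (fun i => w i) := by
  -- Coefficients of x in terms of w. The natural subtractions do not truncate, since `3 ≤ i` in the
  -- second branch.
  set M : Fin (m + 3) → Fin (m + 3) → A := fun i =>
    if h : (i : ℕ) < 3 then fun j => if h' : (j : ℕ) < 3 then N ⟨i, h⟩ ⟨j, h'⟩ else 0
    else Pi.single i 1 + Pi.single ⟨i - 1, by omega⟩ a + Pi.single ⟨i - 2, by omega⟩ b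
      + Pi.single ⟨i - 3, by omega⟩ c with hM
  have hlin : ∀ i : Fin (m + 3),
      x i = Fintype.linearCombination A (fun j : Fin (m + 3) => w j) (M i) := by
    intro i
    by_cases h : (i : ℕ) < 3
    · simp only [hM, dif_pos h]
      have := hx ⟨i, h⟩
      simp only at this
      rw [this, Fintype.linearCombination_apply, Fin.sum_univ_three,
        Fin.sum_univ_eq_sum_range (fun j => (if h' : j < 3 then N ⟨i, h⟩ ⟨j, h'⟩ else 0) • w j)
          (m + 3),
        ← Finset.sum_subset (s₁ := Finset.range 3) (Finset.range_subset_range.2 (by omega))]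
      · simp [Finset.sum_range_succ]
      · intro j _ hj
        rw [dif_neg (by simpa using hj), zero_smul]
    · simp only [hM, dif_neg h, map_add, Fintype.linearCombination_apply_single, one_smul]
      obtain ⟨n, hn⟩ : ∃ n, (i : ℕ) = n + 3 := ⟨i - 3, by omega⟩
      rw [hn, hx']
      rfl
  calc P (fun i => x i) = P (fun i => Fintype.linearCombination A (fun j : Fin (m + 3) => w j) (M i)) := by
        congr 1; funext i; exact hlin i
    _ = _ := by
        rw [alternatingMap_linearCombination, det_eq_det_three]
        · congr 2
          ext i j
          simp [hM]
        · intro i j hj hij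
          have hij' : (i : ℕ) < j := hij
          by_cases h : (i : ℕ) < 3
          · simp only [hM, Matrix.of_apply, dif_pos h]
            rw [dif_neg (by omega)]
          · simp only [hM, Matrix.of_apply, dif_neg h, Pi.add_apply, Pi.single_apply, Fin.ext_iff]
            rw [if_neg (by omega), if_neg (by omega), if_neg (by omega), if_neg (by omega)]
            simp
        · intro i hi
          have h : ¬ (i : ℕ) < 3 := by omega
          simp only [hM, Matrix.of_apply, dif_neg h, Pi.add_apply, Pi.single_apply, Fin.ext_iff]
          rw [if_pos trivial, if_neg (by omega), if_neg (by omega), if_neg (by omega)]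
          simp

/-! ### Difference operators on sequences and their determinants -/

/-- The operator `u_j ↦ u_j - y u_{j-1}` on sequences. -/
def diffOp (y : A) (u : ℤ → V) : ℤ → V := fun j => u j - y • u (j - 1)

lemma diffOp_comm (y z : A) (u : ℤ → V) : diffOp y (diffOp z u) = diffOp z (diffOp y u) := by
  funext j
  simp only [diffOp]
  module

/-- An alternating map evaluated at the terms `u_1, …, u_k` of a sequence. -/
def seqEval {k : ℕ} (P : V [⋀^Fin k]→ₗ[A] A) (u : ℤ → V) : A := P fun i => u ((i : ℤ) + 1)

/-- The sequence that starts with `p, q, r` and goes on with `g`. -/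
def cons₃ (p q r : V) (g : ℕ → V) : ℕ → V
  | 0 => p
  | 1 => q
  | 2 => r
  | n + 3 => g n

/-- With u_{j+1} read as T^j, the three head vectors are (T - q)(T - r), (T - p)(T - r), (T - p)(T -
q). Their coefficient determinant is the Vandermonde product, and the tail is unitriangular. -/
lemma alternatingMap_lagrange {m : ℕ} (P : V [⋀^Fin (m + 3)]→ₗ[A] A) (u : ℤ → V) (p q r : A) :
    P (fun i => cons₃ (diffOp q (diffOp r u) 3) (diffOp p (diffOp r u) 3)
        (diffOp p (diffOp q u) 3)
        (fun n => diffOp p (diffOp q (diffOp r u)) ((n : ℤ) + 4)) i) =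
      ((p - q) * (p - r) * (q - r)) * seqEval P u := by
  rw [alternatingMap_head P _ (fun i => u ((i : ℤ) + 1))
    !![q * r, -(q + r), 1; p * r, -(p + r), 1; p * q, -(p + q), 1]
    (-(p + q + r)) (p * q + p * r + q * r) (-(p * q * r))]
  · rw [Matrix.det_fin_three]
    simp only [seqEval, Matrix.of_apply, Matrix.cons_val]
    ring
  · intro i
    fin_cases i <;> simp [Fin.sum_univ_three, cons₃, diffOp] <;> module
  · intro i
    simp only [cons₃, diffOp]
    push_cast
    rw [show (i : ℤ) + 4 - 1 = i + 2 + 1 by ring, show (i : ℤ) + 2 + 1 - 1 = i + 1 + 1 by ring,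
      show (i : ℤ) + 1 + 1 - 1 = i + 1 by ring, show (i : ℤ) + 3 + 1 = i + 4 by ring]
    module

/-- The head determinant is the resultant of (T - a)(T - b) and T - c: its rows are (T - a)(T - b),
T - c and T(T - c). -/
lemma alternatingMap_cons_diffOp {m : ℕ} (P : V [⋀^Fin (m + 3)]→ₗ[A] A) (u : ℤ → V)
    (a b c : A) :
    P (Fin.cons (diffOp a (diffOp b u) 3) fun i : Fin (m + 2) => diffOp c u ((i : ℤ) + 2)) =
      (c - a) * (c - b) * seqEval P u := by
  have e : (Fin.cons (diffOp a (diffOp b u) 3) fun i : Fin (m + 2) => diffOp c u ((i : ℤ) + 2) :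
      Fin (m + 3) → V) = fun i : Fin (m + 3) => cons₃ (diffOp a (diffOp b u) 3) (diffOp c u 2) (diffOp c u 3)
        (fun n => diffOp c u ((n : ℤ) + 4)) i := by
    funext i
    refine Fin.cases ?_ (fun i => ?_) i
    · rfl
    · obtain ⟨i, hi⟩ := i
      match i with
      | 0 => rfl
      | 1 => rfl
      | n + 2 =>
        simp only [Fin.cons_succ, Fin.val_succ, cons₃]
        push_cast
        rfl
  rw [e, alternatingMap_head P _ (fun i => u ((i : ℤ) + 1))
    !![a * b, -(a + b), 1; -c, 1, 0; 0, -c, 1] (-c) 0 0]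
  · rw [Matrix.det_fin_three]
    simp only [seqEval, Matrix.of_apply, Matrix.cons_val]
    ring
  · intro i
    fin_cases i <;> simp [Fin.sum_univ_three, cons₃, diffOp] <;> module
  · intro i
    simp only [cons₃, diffOp]
    push_cast
    rw [show (i : ℤ) + 4 - 1 = i + 2 + 1 by ring, show (i : ℤ) + 3 + 1 = i + 4 by ring]
    module

/-! ### Plücker relations and the Fay identity for alternating maps -/

/-- The Plücker relations for an alternating map. -/
def IsPlucker {k : ℕ} (P : V [⋀^Fin (k + 1)]→ₗ[A] A) : Prop :=
  ∀ (a : Fin k → V) (b : Fin (k + 2) → V),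
    ∑ j : Fin (k + 2), (-1) ^ (j : ℕ) * (P (Fin.cons (b j) a) * P (fun i => b (j.succAbove i))) = 0

lemma alternatingMap_cons_mem_span {k : ℕ} (P : V [⋀^Fin (k + 1)]→ₗ[A] A) (a : Fin k → V) {x : V}
    (hx : x ∈ Submodule.span A (Set.range a)) : P (Fin.cons x a) = 0 := by
  induction hx using Submodule.span_induction with
  | mem x hx =>
    obtain ⟨i, rfl⟩ := hx
    exact P.map_eq_zero_of_eq _ (i := 0) (j := i.succ) (by simp) (Fin.succ_ne_zero i).symm
  | zero => exact P.map_coord_zero 0 (by simp)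
  | add x y _ _ hx hy =>
    have := P.toMultilinearMap.cons_add a x y
    simp only [AlternatingMap.coe_multilinearMap] at this
    rw [this, hx, hy, add_zero]
  | smul r x _ hx =>
    have := P.toMultilinearMap.cons_smul a r x
    simp only [AlternatingMap.coe_multilinearMap] at this
    rw [this, hx, smul_zero]

/-- One Plücker relation, for the families `f` and `B`, chosen so that only the first four terms
survive. In each of them `alternatingMap_cons_diffOp` evaluates the first factor and
`alternatingMap_lagrange` the second. -/
theorem fay_seqEval {m : ℕ} (P : V [⋀^Fin (m + 3)]→ₗ[A] A) (hP : IsPlucker P) (u : ℤ → V)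
    (a b p q r s : A) :
    (p - a) * (p - b) * ((q - r) * (q - s) * (r - s)) *
        (seqEval P (diffOp q (diffOp r (diffOp s u))) *
          seqEval P (diffOp a (diffOp b (diffOp p u)))) -
      (q - a) * (q - b) * ((p - r) * (p - s) * (r - s)) *
        (seqEval P (diffOp p (diffOp r (diffOp s u))) *
          seqEval P (diffOp a (diffOp b (diffOp q u)))) +
      (r - a) * (r - b) * ((p - q) * (p - s) * (q - s)) *
        (seqEval P (diffOp p (diffOp q (diffOp s u))) *
          seqEval P (diffOp a (diffOp b (diffOp r u)))) -
      (s - a) * (s - b) * ((p - q) * (p - r) * (q - r)) *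
        (seqEval P (diffOp p (diffOp q (diffOp r u))) *
          seqEval P (diffOp a (diffOp b (diffOp s u)))) = 0 := by
  set U := diffOp a (diffOp b u) with hU
  set W := diffOp p (diffOp q (diffOp r (diffOp s u))) with hW
  set f : Fin (m + 2) → V := fun i => W ((i : ℤ) + 2) with hf
  set g : ℕ → V := fun n => diffOp a (diffOp b W) ((n : ℤ) + 4) with hg
  -- Each `b` omits one of p, q, r, s. Next to `f`, the omitted parameter is the only one not
  -- shared; with this `b` removed, it becomes common to all the remaining vectors.
  set b₀ := diffOp q (diffOp r (diffOp s U)) 3 with hb₀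
  set b₁ := diffOp p (diffOp r (diffOp s U)) 3 with hb₁
  set b₂ := diffOp p (diffOp q (diffOp s U)) 3 with hb₂
  set b₃ := diffOp p (diffOp q (diffOp r U)) 3 with hb₃
  set B : Fin (m + 4) → V := Fin.cons b₀ fun i => cons₃ b₁ b₂ b₃ g i with hB
  have h := hP f B
  -- The tail of `B` applies two further differences to `W`, so each entry is a combination of three
  -- consecutive entries of `f`.
  have tail : ∀ n : Fin m, P (Fin.cons (B n.succ.succ.succ.succ) f) = 0 := by
    intro n
    apply alternatingMap_cons_mem_span
    have e : B n.succ.succ.succ.succ = f ⟨n + 2, by omega⟩ + (-(a + b)) • f ⟨n + 1, by omega⟩ +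
        (a * b) • f ⟨n, by omega⟩ := by
      simp only [hB, Fin.cons_succ, Fin.val_succ, cons₃, hg, hf, diffOp]
      push_cast
      rw [show (n : ℤ) + 4 - 1 = n + 1 + 2 by ring, show (n : ℤ) + 1 + 2 - 1 = n + 2 by ring,
        show (n : ℤ) + 2 + 2 = n + 4 by ring]
      module
    rw [e]
    refine add_mem (add_mem ?_ ?_) ?_
    · exact Submodule.subset_span ⟨_, rfl⟩
    · exact Submodule.smul_mem _ _ (Submodule.subset_span ⟨_, rfl⟩)
    · exact Submodule.smul_mem _ _ (Submodule.subset_span ⟨_, rfl⟩)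
  rw [Fin.sum_univ_succ, Fin.sum_univ_succ, Fin.sum_univ_succ, Fin.sum_univ_succ,
    Finset.sum_eq_zero (fun n _ => by rw [tail n]; ring)] at h
  have t₀ : P (Fin.cons (B 0) f) = (p - a) * (p - b) * seqEval P (diffOp q (diffOp r (diffOp s u))) := by
    rw [← alternatingMap_cons_diffOp]
    -- Here and below, commutativity brings the difference operators on both sides into one common
    -- order.
    simp only [hB, hb₀, hU, hf, hW, Fin.cons_zero, diffOp_comm]
  have t₁ : P (Fin.cons (B (Fin.succ 0)) f) =
      (q - a) * (q - b) * seqEval P (diffOp p (diffOp r (diffOp s u))) := by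
    rw [← alternatingMap_cons_diffOp]
    simp only [hB, hb₁, hU, hf, hW, Fin.cons_succ, Fin.val_zero, cons₃, diffOp_comm]
  have t₂ : P (Fin.cons (B (Fin.succ (Fin.succ 0))) f) =
      (r - a) * (r - b) * seqEval P (diffOp p (diffOp q (diffOp s u))) := by
    rw [← alternatingMap_cons_diffOp]
    simp only [hB, hb₂, hU, hf, hW, Fin.cons_succ, Fin.val_zero, Fin.val_succ, cons₃, diffOp_comm]
  have t₃ : P (Fin.cons (B (Fin.succ (Fin.succ (Fin.succ 0)))) f) =
      (s - a) * (s - b) * seqEval P (diffOp p (diffOp q (diffOp r u))) := by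
    rw [← alternatingMap_cons_diffOp]
    simp only [hB, hb₃, hU, hf, hW, Fin.cons_succ, Fin.val_zero, Fin.val_succ, cons₃, diffOp_comm]
  have hB' : ∀ i : Fin (m + 4), B i = Nat.casesOn (i : ℕ) b₀ (cons₃ b₁ b₂ b₃ g) := by
    intro i
    refine Fin.cases rfl (fun i => rfl) i
  have hsucc : ∀ (j : Fin (m + 4)) (i : Fin (m + 3)),
      ((j.succAbove i : Fin (m + 4)) : ℕ) = if (i : ℕ) < j then (i : ℕ) else i + 1 := by
    intro j i
    simp only [Fin.succAbove, Fin.lt_def, Fin.val_castSucc]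
    split_ifs <;> rfl
  have s₀ : P (fun i => B (Fin.succAbove 0 i)) =
      ((q - r) * (q - s) * (r - s)) * seqEval P (diffOp a (diffOp b (diffOp p u))) := by
    rw [← alternatingMap_lagrange]
    congr 1
    funext i
    rw [hB', hsucc]
    obtain ⟨i, hi⟩ := i
    simp only [Fin.val_zero]
    match i with
    | 0 | 1 | 2 | n + 3 =>
      simp [cons₃]
      simp only [hb₀, hb₁, hb₂, hb₃, hU, hg, hW, diffOp_comm] <;> rfl
  have s₁ : P (fun i => B (Fin.succAbove (Fin.succ 0) i)) =
      ((p - r) * (p - s) * (r - s)) * seqEval P (diffOp a (diffOp b (diffOp q u))) := by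
    rw [← alternatingMap_lagrange]
    congr 1
    funext i
    rw [hB', hsucc]
    obtain ⟨i, hi⟩ := i
    simp only [Fin.val_succ, Fin.val_zero]
    match i with
    | 0 | 1 | 2 | n + 3 =>
      simp [cons₃]
      simp only [hb₀, hb₁, hb₂, hb₃, hU, hg, hW, diffOp_comm] <;> rfl
  have s₂ : P (fun i => B (Fin.succAbove (Fin.succ (Fin.succ 0)) i)) =
      ((p - q) * (p - s) * (q - s)) * seqEval P (diffOp a (diffOp b (diffOp r u))) := by
    rw [← alternatingMap_lagrange]
    congr 1
    funext i
    rw [hB', hsucc]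
    obtain ⟨i, hi⟩ := i
    simp only [Fin.val_succ, Fin.val_zero]
    match i with
    | 0 | 1 | 2 | n + 3 =>
      simp [cons₃]
      simp only [hb₀, hb₁, hb₂, hb₃, hU, hg, hW, diffOp_comm] <;> rfl
  have s₃ : P (fun i => B (Fin.succAbove (Fin.succ (Fin.succ (Fin.succ 0))) i)) =
      ((p - q) * (p - r) * (q - r)) * seqEval P (diffOp a (diffOp b (diffOp s u))) := by
    rw [← alternatingMap_lagrange]
    congr 1
    funext i
    rw [hB', hsucc]
    obtain ⟨i, hi⟩ := i
    simp only [Fin.val_succ, Fin.val_zero]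
    match i with
    | 0 | 1 | 2 | n + 3 =>
      simp [cons₃]
      simp only [hb₀, hb₁, hb₂, hb₃, hU, hg, hW, diffOp_comm] <;> rfl
  rw [t₀, t₁, t₂, t₃, s₀, s₁, s₂, s₃] at h
  simp only [Fin.val_zero, Fin.val_succ] at h
  linear_combination h

end Alternating

/-! ### The alternating form defined by Plücker coordinates -/

/-- Multilinear expansion of both factors. Putting the index J_j back among the others makes the
weight ∏ a ∏ b independent of j, so each pair (I, J) contributes a multiple of one relation on basis
vectors. -/
lemma plucker_expand {ι A : Type*} [Fintype ι] [CommRing A] {k : ℕ} (c : (Fin (k + 1) → ι) → A)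
    (hc : ∀ (I : Fin k → ι) (J : Fin (k + 2) → ι), ∑ j : Fin (k + 2), (-1) ^ (j : ℕ) *
      (c (Fin.cons (J j) I) * c fun i => J (j.succAbove i)) = 0)
    (a : Fin k → ι → A) (b : Fin (k + 2) → ι → A) :
    ∑ j : Fin (k + 2), (-1) ^ (j : ℕ) *
      ((∑ L, c L * ∏ i, (Fin.cons (b j) a : Fin (k + 1) → ι → A) i (L i)) *
        ∑ M, c M * ∏ i, b (j.succAbove i) (M i)) = 0 := by
  have key : ∀ j : Fin (k + 2),
      (∑ L, c L * ∏ i, (Fin.cons (b j) a : Fin (k + 1) → ι → A) i (L i)) *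
        (∑ M, c M * ∏ i, b (j.succAbove i) (M i)) =
      ∑ I : Fin k → ι, ∑ J : Fin (k + 2) → ι, ((∏ i, a i (I i)) * ∏ i, b i (J i)) *
        (c (Fin.cons (J j) I) * c fun i => J (j.succAbove i)) := by
    intro j
    rw [← (Fin.consEquiv fun _ : Fin (k + 1) => ι).sum_comp, Fintype.sum_prod_type,
      Finset.sum_comm, Finset.sum_mul]
    refine Finset.sum_congr rfl fun I _ => ?_
    rw [← (Fin.insertNthEquiv (fun _ : Fin (k + 2) => ι) j).sum_comp, Fintype.sum_prod_type,
      Finset.sum_mul]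
    refine Finset.sum_congr rfl fun x _ => ?_
    rw [Finset.mul_sum]
    refine Finset.sum_congr rfl fun M _ => ?_
    simp only [Fin.consEquiv_apply, Fin.insertNthEquiv_apply, Fin.insertNth_apply_same,
      Fin.insertNth_apply_succAbove]
    rw [Fin.prod_univ_succ, Fin.prod_univ_succAbove _ j]
    simp only [Fin.cons_zero, Fin.cons_succ, Fin.insertNth_apply_same,
      Fin.insertNth_apply_succAbove]
    change c (Fin.cons x I) * _ * (c M * _) = _
    ring
  simp only [key, Finset.mul_sum]
  rw [Finset.sum_comm]
  refine Finset.sum_eq_zero fun I _ => ?_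
  rw [Finset.sum_comm]
  refine Finset.sum_eq_zero fun J _ => ?_
  have h := congrArg (fun x => ((∏ i, a i (I i)) * ∏ i, b i (J i)) * x) (hc I J)
  simp only [mul_zero, Finset.mul_sum] at h
  rw [← h]
  exact Finset.sum_congr rfl fun j _ => by ring

/-! #### The skew-symmetric symbols -/

/-- Any sorting permutation computes the symbol, because an injective tuple has only one; signs can
then be found without unfolding `Tuple.sort`. -/
lemma piTilde_eq {k : ℕ} (L : Fin k → ℤ) (τ : Equiv.Perm (Fin k)) (h : StrictMono (L ∘ τ)) :
    piTilde L = ((Equiv.Perm.sign τ : ℤ) : PluckerRing) *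
      MvPolynomial.X (partitionOfTuple (L ∘ τ) h) := by
  have hL : Function.Injective L := by
    have := h.injective.comp τ.symm.injective
    simpa [Function.comp_assoc] using this
  have hτ : τ = Tuple.sort L := by
    have := Tuple.unique_monotone h.monotone (Tuple.monotone_sort L)
    ext i
    exact congrArg _ (hL (congrFun this i))
  subst hτ
  rw [piTilde, dif_pos hL]

lemma piTilde_of_not_injective {k : ℕ} {L : Fin k → ℤ} (h : ¬ Function.Injective L) :
    piTilde L = 0 := by
  rw [piTilde, dif_neg h]

lemma piTilde_comp_perm {k : ℕ} (L : Fin k → ℤ) (σ : Equiv.Perm (Fin k)) :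
    piTilde (L ∘ σ) = ((Equiv.Perm.sign σ : ℤ) : PluckerRing) * piTilde L := by
  by_cases h : Function.Injective L
  · have h1 := (Tuple.monotone_sort L).strictMono_of_injective
      (h.comp (Tuple.sort L).injective)
    have e : (L ∘ σ) ∘ (σ⁻¹ * Tuple.sort L : Equiv.Perm (Fin k)) = L ∘ Tuple.sort L := by
      funext i
      simp
    have h2 : StrictMono ((L ∘ σ) ∘ (σ⁻¹ * Tuple.sort L : Equiv.Perm (Fin k))) := by rwa [e]
    rw [piTilde_eq _ _ h2, piTilde_eq L _ h1]
    simp only [e]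
    rw [Equiv.Perm.sign_mul, Equiv.Perm.sign_inv]
    push_cast
    ring
  · rw [piTilde_of_not_injective h, piTilde_of_not_injective, mul_zero]
    intro h'
    apply h
    have := h'.comp σ.symm.injective
    simpa [Function.comp_assoc] using this

/-- The rotation sign does not depend on the entry moved, so it factors out of a whole Plücker form.
-/
lemma piTilde_snoc {k : ℕ} (I : Fin k → ℤ) (x : ℤ) :
    piTilde (Fin.snoc I x : Fin (k + 1) → ℤ) =
      ((Equiv.Perm.sign (finRotate (k + 1)) : ℤ) : PluckerRing) *
        piTilde (Fin.cons x I : Fin (k + 1) → ℤ) := by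
  rw [← piTilde_comp_perm]
  congr 1
  exact Fin.snoc_eq_cons_rotate _ _

/-! #### Partitions in a box -/

/-- The tuple `μ_i - i` (`1 ≤ i ≤ k`) of a partition `μ`. -/
def rowTuple (μ : YoungDiagram) (k : ℕ) (i : Fin k) : ℤ := (μ.rowLen i : ℤ) - (i : ℤ) - 1

lemma strictAnti_rowTuple (μ : YoungDiagram) (k : ℕ) : StrictAnti (rowTuple μ k) := by
  intro i j hij
  have h1 := μ.rowLen_anti i j hij.le
  have h2 : (i : ℕ) < j := hij
  simp only [rowTuple]
  omega

lemma strictMono_rowTuple_rev (μ : YoungDiagram) (k : ℕ) :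
    StrictMono (rowTuple μ k ∘ (Fin.revPerm : Equiv.Perm (Fin k))) := by
  intro i j hij
  exact strictAnti_rowTuple μ k (by simpa using hij)

lemma rowLen_eq_zero {μ : YoungDiagram} {k : ℕ} (h : μ.colLen 0 ≤ k) : μ.rowLen k = 0 := by
  by_contra hne
  have h1 : (k, 0) ∈ μ := YoungDiagram.mem_iff_lt_rowLen.2 (Nat.pos_of_ne_zero hne)
  have := YoungDiagram.mem_iff_lt_colLen.1 h1
  omega

lemma ext_rowLen {μ ν : YoungDiagram} (h : ∀ i, μ.rowLen i = ν.rowLen i) : μ = ν := by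
  ext ⟨i, j⟩
  simp only [YoungDiagram.mem_cells, YoungDiagram.mem_iff_lt_rowLen, h]

lemma mem_partitionOfTuple {k : ℕ} (L : Fin k → ℤ) (hL : StrictMono L) {i j : ℕ} :
    (i, j) ∈ partitionOfTuple L hL ↔
      ∃ h : i < k, j < (L (Fin.rev ⟨i, h⟩) + (i : ℤ) + 1).toNat := by
  rw [partitionOfTuple, YoungDiagram.mem_ofRowLens]
  simp

lemma rowLen_partitionOfTuple {k : ℕ} (L : Fin k → ℤ) (hL : StrictMono L) (i : Fin k) :
    (partitionOfTuple L hL).rowLen i = (L (Fin.rev i) + (i : ℤ) + 1).toNat := by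
  have h : ∀ j, j < (partitionOfTuple L hL).rowLen i ↔ j < (L (Fin.rev i) + (i : ℤ) + 1).toNat := by
    intro j
    rw [← YoungDiagram.mem_iff_lt_rowLen, mem_partitionOfTuple]
    simp
  exact le_antisymm (not_lt.1 fun h' => lt_irrefl _ ((h _).1 h'))
    (not_lt.1 fun h' => lt_irrefl _ ((h _).2 h'))

lemma partitionOfTuple_rowTuple {μ : YoungDiagram} {k : ℕ} (h : μ.colLen 0 ≤ k)
    (h' : StrictMono (rowTuple μ k ∘ (Fin.revPerm : Equiv.Perm (Fin k)))) :
    partitionOfTuple (rowTuple μ k ∘ (Fin.revPerm : Equiv.Perm (Fin k))) h' = μ := by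
  apply ext_rowLen
  intro i
  by_cases hi : i < k
  · rw [rowLen_partitionOfTuple _ _ ⟨i, hi⟩]
    simp [rowTuple]
    omega
  · rw [rowLen_eq_zero (h.trans (not_lt.1 hi))]
    by_contra hne
    obtain ⟨h1, -⟩ := (mem_partitionOfTuple _ h').1
      (YoungDiagram.mem_iff_lt_rowLen.2 (Nat.pos_of_ne_zero hne))
    exact hi h1

lemma finite_box (k : ℕ) : {μ : YoungDiagram | μ.colLen 0 ≤ k ∧ μ.rowLen 0 ≤ k}.Finite := by
  have hinj : Function.Injective (fun μ : YoungDiagram => μ.cells) := fun _ _ h =>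
    YoungDiagram.ext h
  refine ((Finset.finite_toSet (Finset.range k ×ˢ Finset.range k).powerset).preimage
    hinj.injOn).subset ?_
  rintro μ ⟨h1, h2⟩
  simp only [Set.mem_preimage, Finset.mem_coe, Finset.mem_powerset]
  rintro ⟨i, j⟩ hij
  rw [YoungDiagram.mem_cells] at hij
  have hi := YoungDiagram.mem_iff_lt_colLen.1 (μ.up_left_mem le_rfl (Nat.zero_le _) hij)
  have hj := YoungDiagram.mem_iff_lt_rowLen.1 (μ.up_left_mem (Nat.zero_le _) le_rfl hij)
  simp only [Finset.mem_product, Finset.mem_range]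
  omega

/-- The partitions contained in the `k × k` square. -/
def box (k : ℕ) : Finset YoungDiagram := (finite_box k).toFinset

lemma mem_box {k : ℕ} {μ : YoungDiagram} : μ ∈ box k ↔ μ.colLen 0 ≤ k ∧ μ.rowLen 0 ≤ k := by
  simp [box]

lemma le_strictMono_apply {k : ℕ} {L : Fin k → ℤ} (hL : StrictMono L) {a : ℤ} (h : ∀ i, a ≤ L i)
    (i : Fin k) : a + i ≤ L i := by
  obtain ⟨i, hi⟩ := i
  induction i with
  | zero => simpa using h ⟨0, hi⟩
  | succ n ih =>
    have h1 := ih (by omega)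
    have h2 : L ⟨n, by omega⟩ < L ⟨n + 1, hi⟩ := hL (by simp)
    push_cast at h1 ⊢
    linarith

/-- With `rowTuple_comp_injective` and `rowTuple_mem_Icc` this gives a bijection between injective
k-tuples in [-k, k - 1] and pairs of a partition in the k × k square and a permutation. -/
lemma exists_box_of_injective {k : ℕ} {L : Fin k → ℤ} (hL : Function.Injective L)
    (hL' : ∀ i, L i ∈ Finset.Icc (-(k : ℤ)) (k - 1)) :
    ∃ μ ∈ box k, ∃ σ : Equiv.Perm (Fin k), rowTuple μ k ∘ σ = L := by
  have hs := (Tuple.monotone_sort L).strictMono_of_injective (hL.comp (Tuple.sort L).injective)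
  simp only [Finset.mem_Icc] at hL'
  have hrow : ∀ i : Fin k, ((partitionOfTuple _ hs).rowLen i : ℤ) =
      L (Tuple.sort L (Fin.rev i)) + i + 1 := by
    intro i
    rw [rowLen_partitionOfTuple]
    -- An increasing tuple with entries ≥ -k has its j-th entry (from 0) ≥ -k + j, so `toNat`
    -- truncates nothing.
    have := le_strictMono_apply hs (fun i => (hL' _).1) (Fin.rev i)
    rw [Fin.val_rev] at this
    have hi := i.isLt
    simp only [Function.comp_apply] at this ⊢
    omega
  refine ⟨partitionOfTuple _ hs, mem_box.2 ⟨?_, ?_⟩, (Fin.revPerm * (Tuple.sort L)⁻¹), ?_⟩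
  · by_contra hne
    obtain ⟨h1, -⟩ := (mem_partitionOfTuple _ hs).1
      (YoungDiagram.mem_iff_lt_colLen.2 (not_le.1 hne))
    exact lt_irrefl _ h1
  · by_cases hk : 0 < k
    · have := hrow ⟨0, hk⟩
      have h2 := (hL' (Tuple.sort L (Fin.rev ⟨0, hk⟩))).2
      simp only at this
      push_cast at this
      omega
    · by_contra hne
      obtain ⟨h1, -⟩ := (mem_partitionOfTuple _ hs).1
        (YoungDiagram.mem_iff_lt_rowLen.2 (lt_of_le_of_lt (Nat.zero_le _) (not_le.1 hne)))
      exact hk h1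
  · funext i
    simp only [Function.comp_apply, rowTuple, Equiv.Perm.mul_apply]
    rw [hrow]
    simp
    ring_nf

lemma rowTuple_comp_injective {k : ℕ} {μ ν : YoungDiagram} (hμ : μ ∈ box k) (hν : ν ∈ box k)
    {σ ρ : Equiv.Perm (Fin k)} (h : rowTuple μ k ∘ σ = rowTuple ν k ∘ ρ) : μ = ν ∧ σ = ρ := by
  have h1 : rowTuple μ k ∘ (Fin.revPerm : Equiv.Perm (Fin k)) =
      rowTuple ν k ∘ (Fin.revPerm : Equiv.Perm (Fin k)) := by
    have e : ∀ (κ : YoungDiagram) (τ : Equiv.Perm (Fin k)),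
        rowTuple κ k ∘ (Fin.revPerm : Equiv.Perm (Fin k)) =
          (rowTuple κ k ∘ τ) ∘ (τ⁻¹ * Fin.revPerm : Equiv.Perm (Fin k)) := by
      intro κ τ
      funext i
      simp
    have m1 := (strictMono_rowTuple_rev μ k).monotone
    have m2 := (strictMono_rowTuple_rev ν k).monotone
    rw [e μ σ] at m1
    rw [e ν ρ, ← h] at m2
    rw [e μ σ, e ν ρ, ← h]
    exact Tuple.unique_monotone m1 m2
  have h2 : μ = ν := by
    rw [← partitionOfTuple_rowTuple (mem_box.1 hμ).1 (strictMono_rowTuple_rev μ k),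
      ← partitionOfTuple_rowTuple (mem_box.1 hν).1 (strictMono_rowTuple_rev ν k)]
    simp only [h1]
  subst h2
  refine ⟨rfl, ?_⟩
  ext i
  exact congrArg _ ((strictAnti_rowTuple μ k).injective (congrFun h i))

lemma rowTuple_mem_Icc {k : ℕ} {μ : YoungDiagram} (hμ : μ ∈ box k) (i : Fin k) :
    rowTuple μ k i ∈ Finset.Icc (-(k : ℤ)) (k - 1) := by
  have h1 := μ.rowLen_anti 0 i (Nat.zero_le _)
  have h2 := (mem_box.1 hμ).2
  have := i.isLt
  simp only [rowTuple, Finset.mem_Icc]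
  omega

/-! #### The alternating form -/

section

variable {A : Type*} [CommRing A] [Algebra ℂ A]

/-- The truncation to the partitions in the `k × k` square of the alternating form with
coefficients `π̃_L`. -/
def boxForm (v : YoungDiagram → ℂ) (k : ℕ) : (ℤ → A) [⋀^Fin k]→ₗ[A] A :=
  ∑ μ ∈ box k, algebraMap ℂ A (v μ) •
    Matrix.detRowAlternating.compLinearMap (LinearMap.funLeft A A (rowTuple μ k))

lemma boxForm_apply (v : YoungDiagram → ℂ) (k : ℕ) (φ : Fin k → ℤ → A) :
    boxForm v k φ = ∑ μ ∈ box k, algebraMap ℂ A (v μ) *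
      (Matrix.of fun i j => φ j (rowTuple μ k i)).det := by
  rw [boxForm]
  refine (map_sum ({ toFun := fun P => P φ, map_zero' := rfl, map_add' := fun _ _ => rfl } :
    ((ℤ → A) [⋀^Fin k]→ₗ[A] A) →+ A) _ _).trans ?_
  refine Finset.sum_congr rfl fun μ _ => ?_
  change algebraMap ℂ A (v μ) * _ = _
  rw [← Matrix.det_transpose]
  rfl

/-- Non-injective tuples contribute 0, and the others group by partition into the Leibniz expansion
of a determinant. The global sign arises because `rowTuple` is decreasing while π̃ is normalised on
increasing tuples. -/
lemma sum_piTilde_eq (v : YoungDiagram → ℂ) (k : ℕ) (φ : Fin k → ℤ → A) :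
    ∑ L : Fin k → Finset.Icc (-(k : ℤ)) (k - 1),
        algebraMap ℂ A (MvPolynomial.eval v (piTilde fun i => (L i : ℤ))) * ∏ i, φ i (L i) =
      ((Equiv.Perm.sign (Fin.revPerm : Equiv.Perm (Fin k)) : ℤ) : A) * boxForm v k φ := by
  classical
  set s := Finset.Icc (-(k : ℤ)) (k - 1)
  set F : (Fin k → ℤ) → A := fun L =>
    algebraMap ℂ A (MvPolynomial.eval v (piTilde L)) * ∏ i, φ i (L i) with hF
  have step : ∑ L : Fin k → s, F (fun i => (L i : ℤ)) =
      ∑ L ∈ Fintype.piFinset fun _ : Fin k => s, F L := by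
    refine Finset.sum_of_injOn (fun L i => (L i : ℤ)) ?_ ?_ ?_ ?_
    · intro L _ M _ h
      funext i
      exact Subtype.ext (congrFun h i)
    · intro L _
      simp
    · intro L hL hL'
      exact absurd ⟨fun i => ⟨L i, Fintype.mem_piFinset.1 hL i⟩, by simp, rfl⟩ hL'
    · intro L _
      rfl
  change ∑ L : Fin k → s, F (fun i => (L i : ℤ)) = _
  rw [step, boxForm_apply, Finset.mul_sum]
  have expand : ∀ μ ∈ box k, ((Equiv.Perm.sign (Fin.revPerm : Equiv.Perm (Fin k)) : ℤ) : A) *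
      (algebraMap ℂ A (v μ) * (Matrix.of fun i j => φ j (rowTuple μ k i)).det) =
      ∑ σ : Equiv.Perm (Fin k), F (rowTuple μ k ∘ σ) := by
    intro μ hμ
    rw [Matrix.det_apply', Finset.mul_sum, Finset.mul_sum]
    refine Finset.sum_congr rfl fun σ _ => ?_
    have e : rowTuple μ k ∘ (Fin.revPerm : Equiv.Perm (Fin k)) =
        (rowTuple μ k ∘ σ) ∘ (σ⁻¹ * Fin.revPerm : Equiv.Perm (Fin k)) := by
      funext i
      simp
    have hm := strictMono_rowTuple_rev μ k
    rw [e] at hm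
    simp only [hF]
    rw [piTilde_eq _ _ hm]
    simp only [← e]
    rw [partitionOfTuple_rowTuple (mem_box.1 hμ).1, Equiv.Perm.sign_mul, Equiv.Perm.sign_inv]
    simp only [map_mul, MvPolynomial.eval_X, map_intCast, Units.val_mul, Matrix.of_apply,
      Function.comp_apply]
    push_cast
    ring
  rw [Finset.sum_congr rfl expand, ← Finset.sum_product']
  symm
  refine Finset.sum_of_injOn (fun p => rowTuple p.1 k ∘ p.2) ?_ ?_ ?_ ?_
  · rintro ⟨μ, σ⟩ h1 ⟨ν, ρ⟩ h2 h
    simp only [Finset.coe_product, Set.mem_prod, Finset.mem_coe] at h1 h2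
    obtain ⟨h3, h4⟩ := rowTuple_comp_injective h1.1 h2.1 h
    exact Prod.ext h3 h4
  · rintro ⟨μ, σ⟩ h1
    simp only [Finset.coe_product, Set.mem_prod, Finset.mem_coe] at h1
    simp only [Finset.mem_coe, Fintype.mem_piFinset]
    exact fun i => rowTuple_mem_Icc h1.1 _
  · intro L hL hL'
    rw [hF]
    simp only
    rw [piTilde_of_not_injective, map_zero, map_zero, zero_mul]
    intro hinj
    obtain ⟨μ, hμ, σ, h⟩ := exists_box_of_injective hinj (Fintype.mem_piFinset.1 hL)
    exact hL' ⟨(μ, σ), by simpa using hμ, h⟩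
  · intro p _
    rfl

/-! ### From the Plücker ideal to the truncated form -/

/-- All elements of the Plücker ideal vanish at `v`. -/
def IsPluckerPoint (v : YoungDiagram → ℂ) : Prop :=
  ∀ f ∈ pluckerIdeal, MvPolynomial.eval v f = 0

lemma intCast_sign_mul_self {R : Type*} [Ring R] {k : ℕ} (σ : Equiv.Perm (Fin k)) :
    ((Equiv.Perm.sign σ : ℤ) : R) * ((Equiv.Perm.sign σ : ℤ) : R) = 1 := by
  rcases Int.units_eq_one_or (Equiv.Perm.sign σ) with h | h <;> simp [h]

lemma IsPluckerPoint.sum_eq_zero {v : YoungDiagram → ℂ} (hv : IsPluckerPoint v) {m : ℕ}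
    (I : Fin m → ℤ) (J : Fin (m + 2) → ℤ)
    (hI : ∀ i, I i ∈ Finset.Icc (-((m + 1 : ℕ) : ℤ)) ((m + 1 : ℕ) - 1))
    (hJ : ∀ i, J i ∈ Finset.Icc (-((m + 1 : ℕ) : ℤ)) ((m + 1 : ℕ) - 1)) :
    ∑ j : Fin (m + 2), (-1) ^ (j : ℕ) *
      (MvPolynomial.eval v (piTilde (Fin.cons (J j) I : Fin (m + 1) → ℤ)) *
        MvPolynomial.eval v (piTilde fun i => J (j.succAbove i))) = 0 := by
  have h := hv (pluckerForm I J) (Ideal.subset_span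
    -- With k = m + 1 and n = 2k the admissible entries -k, …, n - k - 1 fill exactly the symmetric
    -- range of the k × k square.
    ⟨m + 1, 2 * (m + 1), by omega, m, I, J, rfl, fun a => ?_, fun a => ?_, rfl⟩)
  · rw [pluckerForm, map_sum] at h
    -- The factor corrects both the shift (-1)^(j+1) versus (-1)^j and the rotation from `snoc` to
    -- `cons`.
    have h' := congrArg
      (fun x => -(((Equiv.Perm.sign (finRotate (m + 1)) : ℤ) : ℂ) * x)) h
    simp only [mul_zero, neg_zero] at h'
    rw [← h', Finset.mul_sum, ← Finset.sum_neg_distrib]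
    refine Finset.sum_congr rfl fun j _ => ?_
    rw [piTilde_snoc]
    simp only [map_mul, map_pow, map_neg, map_one, map_intCast]
    have := intCast_sign_mul_self (R := ℂ) (finRotate (m + 1))
    linear_combination (-(-1) ^ (j : ℕ) *
      (MvPolynomial.eval v (piTilde (Fin.cons (J j) I : Fin (m + 1) → ℤ)) *
        MvPolynomial.eval v (piTilde fun i => J (j.succAbove i)))) * this
  · have := Finset.mem_Icc.1 (hI a)
    push_cast at this ⊢
    constructor <;> linarith
  · have := Finset.mem_Icc.1 (hJ a)
    push_cast at this ⊢
    constructor <;> linarith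

/-- The relation is quadratic, so the global sign `ε` of `sum_piTilde_eq` enters squared and
disappears. -/
lemma IsPluckerPoint.isPlucker_boxForm {v : YoungDiagram → ℂ} (hv : IsPluckerPoint v) (m : ℕ) :
    IsPlucker (boxForm (A := A) v (m + 1)) := by
  intro a b
  set ε : A := ((Equiv.Perm.sign (Fin.revPerm : Equiv.Perm (Fin (m + 1))) : ℤ) : A)
  have hε : ε * ε = 1 := intCast_sign_mul_self _
  have h := plucker_expand
    (fun L : Fin (m + 1) → Finset.Icc (-((m + 1 : ℕ) : ℤ)) ((m + 1 : ℕ) - 1) =>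
      algebraMap ℂ A (MvPolynomial.eval v (piTilde fun i => (L i : ℤ)))) ?_
    (fun i x => a i x) (fun i x => b i x)
  · have e1 : ∀ j, (∑ L : Fin (m + 1) → Finset.Icc (-((m + 1 : ℕ) : ℤ)) ((m + 1 : ℕ) - 1),
        algebraMap ℂ A (MvPolynomial.eval v (piTilde fun i => (L i : ℤ))) *
          ∏ i, (Fin.cons (fun x : Finset.Icc (-((m + 1 : ℕ) : ℤ)) ((m + 1 : ℕ) - 1) => b j x)
            (fun i x => a i x) : Fin (m + 1) → _ → A) i (L i)) =
        ε * boxForm v (m + 1) (Fin.cons (b j) a) := by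
      intro j
      rw [← sum_piTilde_eq]
      refine Finset.sum_congr rfl fun L _ => ?_
      congr 1
      refine Finset.prod_congr rfl fun i _ => ?_
      refine Fin.cases ?_ (fun i => ?_) i <;> simp
    have e2 : ∀ j : Fin (m + 2),
        (∑ L : Fin (m + 1) → Finset.Icc (-((m + 1 : ℕ) : ℤ)) ((m + 1 : ℕ) - 1),
        algebraMap ℂ A (MvPolynomial.eval v (piTilde fun i => (L i : ℤ))) *
          ∏ i, b (j.succAbove i) (L i)) =
        ε * boxForm v (m + 1) (fun i => b (j.succAbove i)) :=
      fun j => sum_piTilde_eq v (m + 1) (fun i => b (j.succAbove i))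
    simp only [e1, e2] at h
    rw [← h]
    refine Finset.sum_congr rfl fun j _ => ?_
    linear_combination -((-1) ^ (j : ℕ) * (boxForm v (m + 1) (Fin.cons (b j) a) *
      boxForm v (m + 1) (fun i => b (j.succAbove i)))) * hε
  · intro I J
    have := congrArg (algebraMap ℂ A)
      (hv.sum_eq_zero (fun i => (I i : ℤ)) (fun i => (J i : ℤ)) (fun i => (I i).2) fun i => (J i).2)
    rw [map_sum, map_zero] at this
    rw [← this]
    refine Finset.sum_congr rfl fun j _ => ?_
    simp only [map_mul, map_pow, map_neg, map_one]
    congr 6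
    funext i
    refine Fin.cases ?_ (fun i => ?_) i <;> simp

end

/-! ### Complete homogeneous functions under the shifts `t ↦ t - [x]` -/

lemma coeff_completeH (n : ℤ) (m : ℕ+ →₀ ℕ) : MvPowerSeries.coeff m (completeH n) =
    if (tWeight m : ℤ) = n then m.prod fun _ a => ((a.factorial : ℂ))⁻¹ else 0 := rfl

lemma completeH_of_neg {n : ℤ} (hn : n < 0) : completeH n = 0 := by
  ext m
  rw [coeff_completeH, if_neg (by omega), map_zero]

lemma tWeight_single (s : ℕ+) (a : ℕ) : tWeight (Finsupp.single s a) = s * a := by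
  simp [tWeight]

lemma tWeight_eq_zero {m : ℕ+ →₀ ℕ} : tWeight m = 0 ↔ m = 0 := by
  constructor
  · intro h
    rw [tWeight, Finsupp.sum, Finset.sum_eq_zero_iff] at h
    ext s
    by_contra hs
    have := h s (by simpa using hs)
    simp at this
    exact hs this
  · rintro rfl
    simp [tWeight]

lemma completeH_zero : completeH 0 = 1 := by
  classical
  ext m
  rw [coeff_completeH, MvPowerSeries.coeff_one]
  by_cases h : m = 0
  · simp [h, tWeight]
  · rw [if_neg h, if_neg]
    exact_mod_cast fun h' => h (tWeight_eq_zero.1 h')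

lemma prod_factorial_add_single (m : ℕ+ →₀ ℕ) (s : ℕ+) :
    ((m s + 1 : ℕ) : ℂ) * ((m + Finsupp.single s 1).prod fun _ a => ((a.factorial : ℂ))⁻¹) =
      m.prod fun _ a => ((a.factorial : ℂ))⁻¹ := by
  classical
  have h1 := Finsupp.mul_prod_erase' m s (fun _ a => ((a.factorial : ℂ))⁻¹) (by simp)
  have h2 := Finsupp.mul_prod_erase' (m + Finsupp.single s 1) s
    (fun _ a => ((a.factorial : ℂ))⁻¹) (by simp)
  have e : (m + Finsupp.single s 1).erase s = m.erase s := by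
    ext i
    by_cases h : i = s <;> simp [Finsupp.erase, h]
  rw [e] at h2
  rw [← h1, ← h2, ← mul_assoc]
  congr 1
  simp only [Finsupp.add_apply, Finsupp.single_eq_same, Nat.factorial_succ]
  have : ((m s + 1 : ℕ) : ℂ) ≠ 0 := Nat.cast_ne_zero.2 (Nat.succ_ne_zero _)
  push_cast at this ⊢
  field_simp

/-- This is t_s ∂h_n/∂t_s = t_s h_{n-s}, read coefficientwise. -/
lemma coeff_X_mul_completeH (n : ℤ) (s : ℕ+) (m : ℕ+ →₀ ℕ) :
    MvPowerSeries.coeff m (MvPowerSeries.X s * completeH (n - s)) =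
      (m s : ℂ) * MvPowerSeries.coeff m (completeH n) := by
  classical
  by_cases hs : m s = 0
  · rw [hs, Nat.cast_zero, zero_mul, MvPowerSeries.X, MvPowerSeries.coeff_monomial_mul, if_neg]
    intro h
    have := h s
    simp [hs] at this
  · obtain ⟨m', rfl⟩ : ∃ m', m = m' + Finsupp.single s 1 := by
      refine ⟨m - Finsupp.single s 1, (tsub_add_cancel_of_le ?_).symm⟩
      simpa using Nat.one_le_iff_ne_zero.2 hs
    rw [MvPowerSeries.X, add_comm m', MvPowerSeries.coeff_add_monomial_mul, add_comm _ m', one_mul,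
      coeff_completeH, coeff_completeH, tWeight_add, tWeight_single]
    by_cases h : (tWeight m' : ℤ) = n - s
    · rw [if_pos h, if_pos (by push_cast; linarith), ← prod_factorial_add_single m' s]
      simp
    · rw [if_neg h, if_neg, mul_zero]
      intro h'
      apply h
      push_cast at h'
      linarith

lemma sum_range_tWeight {m : ℕ+ →₀ ℕ} {n : ℕ} (h : tWeight m ≤ n) :
    ∑ i ∈ Finset.range n, (i + 1) * m i.succPNat = tWeight m := by
  classical
  rw [tWeight, Finsupp.sum]
  symm
  refine Finset.sum_of_injOn (fun s => s.natPred) (PNat.natPred_injective.injOn) ?_ ?_ ?_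
  · intro s hs
    simp only [Finset.coe_range, Set.mem_Iio]
    have h1 : (s : ℕ) * m s ≤ tWeight m :=
      Finset.single_le_sum (f := fun s : ℕ+ => (s : ℕ) * m s) (fun _ _ => Nat.zero_le _) hs
    have h2 : 0 < m s := Nat.pos_of_ne_zero (by simpa using hs)
    have h3 := s.natPred_add_one
    nlinarith
  · intro i _ hi
    rw [mul_eq_zero]
    right
    by_contra hne
    exact hi ⟨i.succPNat, by simpa using hne, by simp⟩
  · intro s _
    simp [PNat.succPNat_natPred]

/-- Euler's identity for the weighted homogeneous h_n: the sum of s m_s over s is the weight of the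
monomial. -/
lemma newton_completeH (n : ℕ) : (n : MvPowerSeries ℕ+ ℂ) * completeH n =
    ∑ i ∈ Finset.range n, ((i + 1 : ℕ) : MvPowerSeries ℕ+ ℂ) *
      (MvPowerSeries.X i.succPNat * completeH ((n : ℤ) - (i + 1 : ℕ))) := by
  ext m
  have hc : ∀ (a : ℕ) (f : MvPowerSeries ℕ+ ℂ),
      MvPowerSeries.coeff m ((a : MvPowerSeries ℕ+ ℂ) * f) = a * MvPowerSeries.coeff m f := by
    intro a f
    rw [← nsmul_eq_mul, map_nsmul, nsmul_eq_mul]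
  rw [hc, map_sum]
  have e : ∀ i ∈ Finset.range n, MvPowerSeries.coeff m (((i + 1 : ℕ) : MvPowerSeries ℕ+ ℂ) *
      (MvPowerSeries.X i.succPNat * completeH ((n : ℤ) - (i + 1 : ℕ)))) =
      (((i + 1) * m i.succPNat : ℕ) : ℂ) * MvPowerSeries.coeff m (completeH n) := by
    intro i _
    rw [hc, show (((i + 1 : ℕ) : ℤ)) = ((i.succPNat : ℕ) : ℤ) from rfl, coeff_X_mul_completeH]
    push_cast
    ring
  rw [Finset.sum_congr rfl e, ← Finset.sum_mul, ← Nat.cast_sum]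
  by_cases h : (tWeight m : ℤ) = n
  · have h' : tWeight m = n := by exact_mod_cast h
    rw [sum_range_tWeight h'.le, h']
  · rw [coeff_completeH, if_neg h, mul_zero, mul_zero]

/-- Sequences satisfying Newton's recursion with parameters `T` are unique. -/
lemma newton_unique {S : Type*} [CommRing S] [Algebra ℂ S] (T : ℕ+ → S) (f g : ℤ → S)
    (hf : ∀ n < 0, f n = 0) (hg : ∀ n < 0, g n = 0) (h0 : f 0 = g 0)
    (hf' : ∀ n : ℕ, (n : S) * f n = ∑ i ∈ Finset.range n,
      ((i + 1 : ℕ) : S) * (T i.succPNat * f ((n : ℤ) - (i + 1 : ℕ))))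
    (hg' : ∀ n : ℕ, (n : S) * g n = ∑ i ∈ Finset.range n,
      ((i + 1 : ℕ) : S) * (T i.succPNat * g ((n : ℤ) - (i + 1 : ℕ)))) : f = g := by
  have key : ∀ n : ℕ, f n = g n := by
    intro n
    induction n using Nat.strong_induction_on with
    | _ n ih =>
      rcases Nat.eq_zero_or_pos n with rfl | hn
      · exact_mod_cast h0
      -- Division by n is allowed in a ℂ-algebra, so the recursion determines the n-th term.
      · have hn' : IsUnit (n : S) := by
          rw [← map_natCast (algebraMap ℂ S)]
          exact (Nat.cast_ne_zero.2 hn.ne').isUnit.map _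
        apply hn'.mul_left_cancel
        rw [hf', hg']
        refine Finset.sum_congr rfl fun i hi => ?_
        have hi' := Finset.mem_range.1 hi
        rw [← Nat.cast_sub (by omega), ih _ (by omega)]
  funext n
  rcases lt_or_ge n 0 with h | h
  · rw [hf n h, hg n h]
  · obtain ⟨n, rfl⟩ := Int.eq_ofNat_of_zero_le h
    exact key n

/-- Newton's recursion under the shift of the parameters by `-[y]`. -/
lemma newton_shift {S : Type*} [CommRing S] (T T' : ℕ+ → S) (y : S) (f : ℤ → S)
    (hT : ∀ s : ℕ+, ((s : ℕ) : S) * T' s = ((s : ℕ) : S) * T s - y ^ (s : ℕ))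
    (hf : ∀ n < 0, f n = 0)
    (hf' : ∀ n : ℕ, (n : S) * f n = ∑ i ∈ Finset.range n,
      ((i + 1 : ℕ) : S) * (T i.succPNat * f ((n : ℤ) - (i + 1 : ℕ)))) (n : ℕ) :
    (n : S) * (f n - y * f ((n : ℤ) - 1)) = ∑ i ∈ Finset.range n, ((i + 1 : ℕ) : S) *
      (T' i.succPNat * (f ((n : ℤ) - (i + 1 : ℕ)) - y * f ((n : ℤ) - (i + 1 : ℕ) - 1))) := by
  rcases n with _ | n
  · simp
  -- The powers of y coming from the parameter shift telescope: the sum of the last brackets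
  -- collapses to -y f(n), since f(-1) = 0.
  have e : ∀ i ∈ Finset.range (n + 1), ((i + 1 : ℕ) : S) * (T' i.succPNat *
      (f (((n + 1 : ℕ) : ℤ) - (i + 1 : ℕ)) - y * f (((n + 1 : ℕ) : ℤ) - (i + 1 : ℕ) - 1))) =
      ((i + 1 : ℕ) : S) * (T i.succPNat * f (((n + 1 : ℕ) : ℤ) - (i + 1 : ℕ))) -
      y * (((i + 1 : ℕ) : S) * (T i.succPNat * f ((n : ℤ) - (i + 1 : ℕ)))) +
      (y ^ (i + 1 + 1) * f ((n : ℤ) - (i + 1 : ℕ)) - y ^ (i + 1) * f ((n : ℤ) - (i : ℕ))) := by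
    intro i _
    have h := hT i.succPNat
    rw [Nat.succPNat_coe] at h
    rw [show ((n + 1 : ℕ) : ℤ) - (i + 1 : ℕ) = n - (i : ℕ) by push_cast; ring,
      show (n : ℤ) - (i : ℕ) - 1 = n - (i + 1 : ℕ) by push_cast; ring]
    simp only [Nat.succ_eq_add_one] at h
    linear_combination (f ((n : ℤ) - (i : ℕ)) - y * f ((n : ℤ) - (i + 1 : ℕ))) * h
  rw [Finset.sum_congr rfl e, Finset.sum_add_distrib, Finset.sum_sub_distrib, ← Finset.mul_sum,
    ← hf', Finset.sum_range_sub (fun i : ℕ => y ^ (i + 1) * f ((n : ℤ) - (i : ℕ))),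
    Finset.sum_range_succ _ n, ← hf', hf ((n : ℤ) - (n + 1 : ℕ)) (by push_cast; linarith)]
  rw [show ((n + 1 : ℕ) : ℤ) - 1 = n by push_cast; ring]
  push_cast
  simp
  ring_nf

/-- The functions `h_j` evaluated at `t + ∑ n_i [x_i]`. -/
def latticeH (n : LatticeA) (j : ℤ) : XTSeries := MvPowerSeries.subst (shiftedT n) (completeH j)

/-- The function `τ` evaluated at `t + ∑ n_i [x_i]`. -/
def latticeTau (v : YoungDiagram → ℂ) (n : LatticeA) : XTSeries :=
  MvPowerSeries.subst (shiftedT n) (tau v)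

lemma latticeH_eq_substAlgHom (n : LatticeA) (j : ℤ) :
    latticeH n j = MvPowerSeries.substAlgHom (R := ℂ) (hasSubst_shiftedT n) (completeH j) := by
  rw [MvPowerSeries.coe_substAlgHom]
  rfl

lemma latticeH_of_neg (n : LatticeA) {j : ℤ} (hj : j < 0) : latticeH n j = 0 := by
  rw [latticeH_eq_substAlgHom, completeH_of_neg hj, map_zero]

lemma latticeH_zero (n : LatticeA) : latticeH n 0 = 1 := by
  rw [latticeH_eq_substAlgHom, completeH_zero, map_one]

lemma newton_latticeH (n : LatticeA) (j : ℕ) : (j : XTSeries) * latticeH n j =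
    ∑ i ∈ Finset.range j, ((i + 1 : ℕ) : XTSeries) *
      (shiftedT n i.succPNat * latticeH n ((j : ℤ) - (i + 1 : ℕ))) := by
  have h := congrArg (MvPowerSeries.substAlgHom (R := ℂ) (hasSubst_shiftedT n)) (newton_completeH j)
  simpa only [map_mul, map_natCast, map_sum, ← latticeH_eq_substAlgHom,
    MvPowerSeries.substAlgHom_X] using h

lemma shiftedT_sub_alpha (n : LatticeA) (i : ℤ) (s : ℕ+) :
    ((s : ℕ) : XTSeries) * shiftedT (n - alpha i) s =
      ((s : ℕ) : XTSeries) * shiftedT n s - xVar i ^ (s : ℕ) := by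
  have e : ∀ m : LatticeA, shiftedT m s = tVar s + m.sum fun i a =>
    MvPowerSeries.C ((a : ℂ) / (s : ℂ)) * xVar i ^ (s : ℕ) := fun _ => rfl
  rw [e, e, Finsupp.sum_sub_index, alpha, Finsupp.sum_single_index]
  · have hs : ((s : ℕ) : ℂ) ≠ 0 := Nat.cast_ne_zero.2 s.ne_zero
    have h : ((s : ℕ) : XTSeries) * MvPowerSeries.C (((1 : ℤ) : ℂ) / ((s : ℕ) : ℂ)) = 1 := by
      rw [← map_natCast (MvPowerSeries.C (σ := ℤ ⊕ ℕ+) (R := ℂ)), ← map_mul]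
      rw [Int.cast_one, mul_one_div_cancel hs, map_one]
    linear_combination (-xVar i ^ (s : ℕ)) * h
  · simp
  · intro i a b
    rw [← sub_mul, ← map_sub]
    congr 2
    push_cast
    ring

/-- The generating series gets multiplied by exp(-∑ x^s z^s / s) = 1 - xz. The proof avoids
exponentials: both sides satisfy the same Newton recursion with the same initial value. -/
lemma latticeH_sub_alpha (n : LatticeA) (i j : ℤ) :
    latticeH (n - alpha i) j = latticeH n j - xVar i * latticeH n (j - 1) := by
  refine congrFun (newton_unique (shiftedT (n - alpha i)) (latticeH (n - alpha i))
    (fun j => latticeH n j - xVar i * latticeH n (j - 1)) (fun j hj => latticeH_of_neg _ hj)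
    (fun j hj => ?_) ?_ (newton_latticeH _) ?_) j
  · rw [latticeH_of_neg _ hj, latticeH_of_neg _ (by linarith), mul_zero, sub_zero]
  · rw [latticeH_zero, latticeH_zero, latticeH_of_neg _ (by norm_num), mul_zero, sub_zero]
  · exact newton_shift (shiftedT n) _ (xVar i) (latticeH n) (shiftedT_sub_alpha n i)
      (fun j hj => latticeH_of_neg _ hj) (newton_latticeH n)

/-! ### The `τ`-function as a limit of alternating forms -/

/-- Each row beyond the length of μ is (0, …, 0, 1) in the corner expansion, so all partitions in a
square can share one matrix size. -/
lemma det_rowLen_eq {R : Type*} [CommRing R] (f : ℤ → R) (h0 : f 0 = 1) (hf : ∀ n < 0, f n = 0)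
    (μ : YoungDiagram) {k : ℕ} (hk : μ.colLen 0 ≤ k) :
    (Matrix.of fun i j : Fin k => f ((μ.rowLen i : ℤ) - (i : ℤ) + (j : ℤ))).det =
      (Matrix.of fun i j : Fin (μ.colLen 0) => f ((μ.rowLen i : ℤ) - (i : ℤ) + (j : ℤ))).det := by
  induction k, hk using Nat.le_induction with
  | base => rfl
  | succ k hk ih =>
    rw [← ih, Matrix.det_succ_row _ (Fin.last k), Finset.sum_eq_single (Fin.last k)]
    · simp only [Matrix.of_apply, Fin.val_last, rowLen_eq_zero hk, Fin.succAbove_last]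
      rw [show ((0 : ℕ) : ℤ) - k + k = 0 by simp, h0, ← two_mul, pow_mul]
      simp
      rfl
    · intro j _ hj
      have : (j : ℕ) < k := Fin.lt_last_iff_ne_last.2 hj
      simp only [Matrix.of_apply, Fin.val_last, rowLen_eq_zero hk]
      rw [hf _ (by push_cast; omega)]
      simp
    · simp

/-- The part of `τ` that comes from partitions in the `k × k` square. -/
def tauBox (v : YoungDiagram → ℂ) (k : ℕ) : MvPowerSeries ℕ+ ℂ := ∑ μ ∈ box k, v μ • schur μ

/-- Jacobi–Trudi: the vector u_{j+1} at L = μ_i - i - 1 (indices from 0) is h_{μ_i - i + j}. -/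
lemma seqEval_boxForm (v : YoungDiagram → ℂ) (k : ℕ) (n : LatticeA) :
    seqEval (boxForm v k) (fun j L => latticeH n (L + j)) =
      MvPowerSeries.subst (shiftedT n) (tauBox v k) := by
  rw [seqEval, boxForm_apply, tauBox, ← MvPowerSeries.coe_substAlgHom (hasSubst_shiftedT n),
    map_sum]
  refine Finset.sum_congr rfl fun μ hμ => ?_
  rw [map_smul, Algebra.smul_def]
  congr 1
  have h : schur μ = (Matrix.of fun i j : Fin k =>
      completeH ((μ.rowLen i : ℤ) - (i : ℤ) + (j : ℤ))).det :=
    (det_rowLen_eq completeH completeH_zero (fun n hn => completeH_of_neg hn) μ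
      (mem_box.1 hμ).1).symm
  rw [h, AlgHom.map_det]
  congr 1
  ext i j : 2
  simp only [Matrix.of_apply, AlgHom.mapMatrix_apply, Matrix.map_apply, rowTuple,
    ← latticeH_eq_substAlgHom]
  congr 1
  ring_nf

lemma eventually_mem_box (μ : YoungDiagram) : ∀ᶠ k in Filter.atTop, μ ∈ box k := by
  filter_upwards [Filter.eventually_ge_atTop (μ.colLen 0), Filter.eventually_ge_atTop (μ.rowLen 0)]
    with k h1 h2
  exact mem_box.2 ⟨h1, h2⟩

lemma eventually_coeff_tauBox (v : YoungDiagram → ℂ) (m : ℕ+ →₀ ℕ) :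
    ∀ᶠ k in Filter.atTop, MvPowerSeries.coeff m (tauBox v k) = MvPowerSeries.coeff m (tau v) := by
  have h := (Filter.eventually_all_finite (finite_support_tau v m)).2
    fun μ _ => eventually_mem_box μ
  filter_upwards [h] with k hk
  rw [tauBox, map_sum]
  change _ = ∑ᶠ μ : YoungDiagram, v μ * MvPowerSeries.coeff m (schur μ)
  rw [finsum_eq_sum_of_support_subset _ (s := box k) fun μ hμ => hk μ hμ]
  rfl

open scoped MvPowerSeries.WithPiTopology in
lemma tendsto_subst_tauBox (v : YoungDiagram → ℂ) (n : LatticeA) :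
    Filter.Tendsto (fun k => MvPowerSeries.subst (shiftedT n) (tauBox v k)) Filter.atTop
      (nhds (latticeTau v n)) := by
  rw [MvPowerSeries.WithPiTopology.tendsto_iff_coeff_tendsto]
  intro e
  apply tendsto_const_nhds.congr'
  -- Taking the series with all coefficients 1 shows that only finitely many monomials can
  -- contribute to the coefficient at `e`, uniformly in k.
  have hfin := MvPowerSeries.coeff_subst_finite (R := ℂ) (hasSubst_shiftedT n) (fun _ => 1) e
  have h := (Filter.eventually_all_finite hfin).2 fun m _ => eventually_coeff_tauBox v m
  filter_upwards [h] with k hk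
  rw [latticeTau, MvPowerSeries.coeff_subst (hasSubst_shiftedT n),
    MvPowerSeries.coeff_subst (hasSubst_shiftedT n)]
  refine finsum_congr fun m => ?_
  by_cases hm : MvPowerSeries.coeff e (m.prod fun s a => shiftedT n s ^ a) = 0
  · rw [hm, smul_zero, smul_zero]
  · rw [hk m]
    change ¬ ((1 : ℂ) • _ = _)
    rwa [one_smul]

open scoped MvPowerSeries.WithPiTopology in
-- The identity holds for every truncation with k ≥ 3 and passes to the limit, as the ring
-- operations are continuous for coefficientwise convergence.
theorem fay_latticeTau {v : YoungDiagram → ℂ} (hv : IsPluckerPoint v) (N : LatticeA)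
    (a b p q r s : ℤ) :
    (xVar p - xVar a) * (xVar p - xVar b) *
        ((xVar q - xVar r) * (xVar q - xVar s) * (xVar r - xVar s)) *
        (latticeTau v (N - (alpha q + alpha r + alpha s)) *
          latticeTau v (N - (alpha a + alpha b + alpha p))) -
      (xVar q - xVar a) * (xVar q - xVar b) *
        ((xVar p - xVar r) * (xVar p - xVar s) * (xVar r - xVar s)) *
        (latticeTau v (N - (alpha p + alpha r + alpha s)) *
          latticeTau v (N - (alpha a + alpha b + alpha q))) +
      (xVar r - xVar a) * (xVar r - xVar b) *
        ((xVar p - xVar q) * (xVar p - xVar s) * (xVar q - xVar s)) *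
        (latticeTau v (N - (alpha p + alpha q + alpha s)) *
          latticeTau v (N - (alpha a + alpha b + alpha r))) -
      (xVar s - xVar a) * (xVar s - xVar b) *
        ((xVar p - xVar q) * (xVar p - xVar r) * (xVar q - xVar r)) *
        (latticeTau v (N - (alpha p + alpha q + alpha r)) *
          latticeTau v (N - (alpha a + alpha b + alpha s))) = 0 := by
  have hop : ∀ (n : LatticeA) (i : ℤ),
      diffOp (xVar i) (fun j L => latticeH n (L + j)) =
        fun j L => latticeH (n - alpha i) (L + j) := by
    intro n i
    funext j L
    simp only [diffOp, Pi.sub_apply, Pi.smul_apply, smul_eq_mul, latticeH_sub_alpha, add_sub_assoc]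
  have hsub : ∀ i j l, N - alpha l - alpha j - alpha i = N - (alpha i + alpha j + alpha l) := by
    intro i j l
    abel
  have ht := fun i j l => tendsto_subst_tauBox v (N - (alpha i + alpha j + alpha l))
  refine tendsto_nhds_unique_of_eventuallyEq
    (((((ht q r s).mul (ht a b p)).const_mul _).sub
      (((ht p r s).mul (ht a b q)).const_mul _)).add
      (((ht p q s).mul (ht a b r)).const_mul _) |>.sub
      (((ht p q r).mul (ht a b s)).const_mul _)) tendsto_const_nhds ?_
  filter_upwards [Filter.eventually_ge_atTop 3] with k hk
  obtain ⟨m, rfl⟩ := Nat.exists_eq_add_of_le' hk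
  have h := fay_seqEval (boxForm (A := XTSeries) v (m + 3)) (hv.isPlucker_boxForm (m + 2))
    (fun j L => latticeH N (L + j)) (xVar a) (xVar b) (xVar p) (xVar q) (xVar r) (xVar s)
  simpa only [hop, hsub, seqEval_boxForm] using h

/-! ### Plücker coordinates of three-dimensional subspaces and the hexahedron recurrence -/

/-- Alternating functions of three indices subject to the Plücker relations. -/
structure IsPlucker₃ {R : Type*} [CommRing R] (G : ℤ → ℤ → ℤ → R) : Prop where
  swap₁₂ : ∀ i j l, G i j l = -G j i l
  swap₂₃ : ∀ i j l, G i j l = -G i l j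
  self₂₃ : ∀ i j, G i j j = 0
  rel : ∀ a b p q r s, G q r s * G a b p - G p r s * G a b q + G p q s * G a b r
    - G p q r * G a b s = 0

namespace IsPlucker₃

variable {R : Type*} [CommRing R] {G : ℤ → ℤ → ℤ → R}

/-- Specialise the general relation to b = s = c; its last term then has a repeated index. -/
lemma three_term (hG : IsPlucker₃ G) (c a p q r : ℤ) :
    G c q r * G c a p - G c p r * G c a q + G c p q * G c a r = 0 := by
  have cyc : ∀ i j, G i j c = G c i j := fun i j => by
    rw [hG.swap₂₃ i j c, hG.swap₁₂ i c j, neg_neg]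
  have h := hG.rel a c p q r c
  have e : ∀ i, G a c i = -G c a i := fun i => hG.swap₁₂ a c i
  rw [hG.self₂₃, cyc, cyc, cyc, e, e, e] at h
  linear_combination -h

/-- The inequality orients antisymmetry, so that rewriting sorts the indices increasingly. -/
lemma swap₁₂_of_lt (hG : IsPlucker₃ G) {i j : ℤ} (_ : j < i) (l : ℤ) :
    G i j l = -G j i l := hG.swap₁₂ i j l

lemma swap₂₃_of_lt (hG : IsPlucker₃ G) (i : ℤ) {j l : ℤ} (_ : l < j) :
    G i j l = -G i l j := hG.swap₂₃ i j l

/-- Three-term relations give XX', YY', ZZ' and H times each shifted X, Y, Z; one four-term relation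
gives H · H123. Everything is multiplied out by H instead of divided, so the identities hold even
where H is a zero divisor. -/
theorem hexahedron (hG : IsPlucker₃ G) :
    G 0 1 2 * G (-3) 0 2 * G (-2) (-1) 1 = -(G 0 1 2 * G (-1) 1 2 * G (-3) (-2) 0)
      + G (-1) 1 2 * G (-2) 0 2 * G (-3) 0 1 - G (-3) 0 2 * G (-1) 0 1 * G (-2) 1 2 ∧
    G 0 1 2 * G (-1) 0 1 * G (-3) (-2) 2 = G 0 1 2 * G (-2) 0 2 * G (-3) (-1) 1
      - G (-1) 1 2 * G (-2) 0 2 * G (-3) 0 1 + G (-3) 0 2 * G (-1) 0 1 * G (-2) 1 2 ∧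
    G 0 1 2 * G (-2) 1 2 * G (-3) (-1) 0 = -(G 0 1 2 * G (-3) 0 1 * G (-2) (-1) 2)
      + G (-1) 1 2 * G (-2) 0 2 * G (-3) 0 1 - G (-3) 0 2 * G (-1) 0 1 * G (-2) 1 2 ∧
    G 0 1 2 * G (-2) 0 1 * G (-3) (-1) 2 = -(G 0 1 2 * G (-1) 1 2 * G (-3) (-2) 0)
      + G (-1) 1 2 * G (-2) 0 2 * G (-3) 0 1 - G (-2) 0 1 * G (-3) 1 2 * G (-1) 0 2 ∧
    G 0 1 2 * G (-3) 1 2 * G (-2) (-1) 0 = G 0 1 2 * G (-2) 0 2 * G (-3) (-1) 1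
      - G (-1) 1 2 * G (-2) 0 2 * G (-3) 0 1 + G (-2) 0 1 * G (-3) 1 2 * G (-1) 0 2 ∧
    G 0 1 2 * G (-1) 0 2 * G (-3) (-2) 1 = -(G 0 1 2 * G (-3) 0 1 * G (-2) (-1) 2)
      + G (-1) 1 2 * G (-2) 0 2 * G (-3) 0 1 - G (-2) 0 1 * G (-3) 1 2 * G (-1) 0 2 ∧
    G 0 1 2 ^ 2 * G (-3) 0 2 * G (-1) 0 1 * G (-2) 1 2 * G (-3) (-2) (-1) =
      (G (-3) 0 2 * G (-1) 0 1 * G (-2) 1 2) ^ 2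
      + G (-3) 0 2 * G (-1) 0 1 * G (-2) 1 2 * (-(2 * G (-1) 1 2 * G (-2) 0 2 * G (-3) 0 1)
        + G 0 1 2 * (G (-1) 1 2 * G (-3) (-2) 0 + G (-2) 0 2 * G (-3) (-1) 1
          + G (-3) 0 1 * G (-2) (-1) 2))
      + (G (-1) 1 2 * G (-2) 0 2 - G 0 1 2 * G (-2) (-1) 2)
        * (G (-1) 1 2 * G (-3) 0 1 - G 0 1 2 * G (-3) (-1) 1)
        * (G (-2) 0 2 * G (-3) 0 1 - G 0 1 2 * G (-3) (-2) 0) := by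
  have hx := hG.three_term 0 (-3) (-2) 1 2
  have hy := hG.three_term 1 (-3) (-1) 0 2
  have hz := hG.three_term 2 (-2) (-1) 0 1
  have h1 := hG.three_term 1 (-2) (-1) 0 2
  have h2 := hG.three_term 2 (-3) (-2) 0 1
  have h3 := hG.three_term 0 (-3) (-1) 1 2
  have h4 := hG.three_term 2 (-3) (-1) 0 1
  have h5 := hG.three_term 0 (-2) (-1) 1 2
  have h6 := hG.three_term 1 (-3) (-2) 0 2
  have h7 := hG.rel 1 2 0 (-3) (-2) (-1)
  simp only [hG.swap₁₂_of_lt (show (-3 : ℤ) < 0 by norm_num),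
    hG.swap₁₂_of_lt (show (-2 : ℤ) < 0 by norm_num),
    hG.swap₁₂_of_lt (show (-1 : ℤ) < 0 by norm_num),
    hG.swap₁₂_of_lt (show (-3 : ℤ) < 1 by norm_num),
    hG.swap₁₂_of_lt (show (-2 : ℤ) < 1 by norm_num),
    hG.swap₁₂_of_lt (show (-1 : ℤ) < 1 by norm_num),
    hG.swap₁₂_of_lt (show (0 : ℤ) < 1 by norm_num),
    hG.swap₁₂_of_lt (show (-3 : ℤ) < 2 by norm_num),
    hG.swap₁₂_of_lt (show (-2 : ℤ) < 2 by norm_num),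
    hG.swap₁₂_of_lt (show (-1 : ℤ) < 2 by norm_num),
    hG.swap₁₂_of_lt (show (0 : ℤ) < 2 by norm_num),
    fun i => hG.swap₂₃_of_lt i (show (-2 : ℤ) < 0 by norm_num),
    fun i => hG.swap₂₃_of_lt i (show (-1 : ℤ) < 0 by norm_num),
    fun i => hG.swap₂₃_of_lt i (show (-2 : ℤ) < 1 by norm_num),
    fun i => hG.swap₂₃_of_lt i (show (-1 : ℤ) < 1 by norm_num),
    fun i => hG.swap₂₃_of_lt i (show (0 : ℤ) < 1 by norm_num),
    fun i => hG.swap₂₃_of_lt i (show (-3 : ℤ) < 2 by norm_num),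
    fun i => hG.swap₂₃_of_lt i (show (-2 : ℤ) < 2 by norm_num),
    fun i => hG.swap₂₃_of_lt i (show (-1 : ℤ) < 2 by norm_num),
    fun i => hG.swap₂₃_of_lt i (show (0 : ℤ) < 2 by norm_num),
    fun i => hG.swap₂₃_of_lt i (show (1 : ℤ) < 2 by norm_num)]
    at hx hy hz h1 h2 h3 h4 h5 h6 h7
  -- Digits record the β's added: β_1, β_2, β_3 replace 0, 1, 2 by -1, -2, -3 in the index triple.
  -- The primed letters are the functions labelled -x, -y, -z.
  generalize G 0 1 2 = H at *
  generalize G (-1) 1 2 = H1 at *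
  generalize G (-2) 0 2 = H2 at *
  generalize G (-3) 0 1 = H3 at *
  generalize G (-2) (-1) 2 = H12 at *
  generalize G (-3) (-1) 1 = H13 at *
  generalize G (-3) (-2) 0 = H23 at *
  generalize G (-3) (-2) (-1) = H123 at *
  generalize G (-3) 0 2 = X at *
  generalize G (-2) 0 1 = X' at *
  generalize G (-1) 0 1 = Y at *
  generalize G (-3) 1 2 = Y' at *
  generalize G (-2) 1 2 = Z at *
  generalize G (-1) 0 2 = Z' at *
  generalize G (-2) (-1) 1 = X'1 at *
  generalize G (-3) (-2) 2 = Y'2 at *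
  generalize G (-3) (-1) 0 = Z'3 at *
  generalize G (-3) (-1) 2 = X1 at *
  generalize G (-2) (-1) 0 = Y2 at *
  generalize G (-3) (-2) 1 = Z3 at *
  have hx' : X * X' = -(H * H23) + H2 * H3 := by
    linear_combination hx
  have hy' : Y * Y' = -(H * H13) + H1 * H3 := by
    linear_combination -hy
  have hz' : Z * Z' = -(H * H12) + H1 * H2 := by
    linear_combination hz
  have h1' : H * X'1 = H1 * X' - Y * Z := by
    linear_combination -h1
  have h2' : H * Y'2 = -(H2 * Y') + X * Z := by
    linear_combination h2
  have h3' : H * Z'3 = H3 * Z' - X * Y := by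
    linear_combination h3
  have h4' : H * X1 = H1 * X - Y' * Z' := by
    linear_combination h4
  have h5' : H * Y2 = -(H2 * Y) + X' * Z' := by
    linear_combination h5
  have h6' : H * Z3 = H3 * Z - X' * Y' := by
    linear_combination -h6
  have h7' : H * H123 = Y2 * Y' - Z'3 * Z + H23 * H1 := by
    linear_combination h7
  refine ⟨?_, ?_, ?_, ?_, ?_, ?_, ?_⟩
  · linear_combination X * h1' + H1 * hx'
  · linear_combination Y * h2' - H2 * hy'
  · linear_combination Z * h3' + H3 * hz'
  · linear_combination X' * h4' + H1 * hx'
  · linear_combination Y' * h5' - H2 * hy'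
  · linear_combination Z' * h6' + H3 * hz'
  -- The triple product on the right is XX' · YY' · ZZ', obtained by substituting the three
  -- factorisations one after another.
  · linear_combination X * Y * Z * (H * h7' + Y' * h5' - Z * h3' - H2 * hy' - H3 * hz')
      + (H1 * H2 - H * H12) * (H1 * H3 - H * H13) * hx'
      + (H1 * H2 - H * H12) * X * X' * hy' + X * X' * Y * Y' * hz'

end IsPlucker₃

/-! ### The normalization factors -/

/-- The pairing `∏_{i < j} (x_i - x_j) ^ {n_i m_j}`, multiplicative in both arguments. -/
def pairing (n m : LatticeA) : XTLocˣ :=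
  n.prod fun i a => m.prod fun j b => if i < j then diffUnit i j ^ (a * b) else 1

lemma vandermonde_eq_pairing (n : LatticeA) : vandermonde n = pairing n n := by
  simp only [vandermonde, pairing, Finsupp.prod, Finset.prod_filter]

lemma pairing_add_left (n n' m : LatticeA) : pairing (n + n') m = pairing n m * pairing n' m := by
  classical
  refine Finsupp.prod_add_index' (fun i => ?_) fun i a b => ?_
  · simp
  · rw [← Finsupp.prod_mul]
    refine Finsupp.prod_congr fun j _ => ?_
    split_ifs
    · rw [add_mul, zpow_add]
    · simp

lemma pairing_add_right (n m m' : LatticeA) : pairing n (m + m') = pairing n m * pairing n m' := by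
  classical
  rw [pairing, pairing, pairing, ← Finsupp.prod_mul]
  refine Finsupp.prod_congr fun i _ => Finsupp.prod_add_index' (fun j => ?_) fun j a b => ?_
  · simp
  · split_ifs
    · rw [mul_add, zpow_add]
    · simp

lemma pairing_alpha {i j : ℤ} (h : i < j) : pairing (alpha i) (alpha j) = diffUnit i j := by
  rw [pairing, alpha, alpha, Finsupp.prod_single_index (by simp),
    Finsupp.prod_single_index (by simp), if_pos h]
  simp

lemma pairing_alpha_of_le {i j : ℤ} (h : j ≤ i) : pairing (alpha i) (alpha j) = 1 := by
  rw [pairing, alpha, alpha, Finsupp.prod_single_index (by simp),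
    Finsupp.prod_single_index (by simp), if_neg (not_lt.2 h)]

/-- The factor of the normalization attached to the removal of `α_i` from `N`. -/
def removalUnit (N : LatticeA) (i : ℤ) : XTLocˣ := (pairing N (alpha i) * pairing (alpha i) N)⁻¹

/-- Bimultiplicativity splits the value at N - s into a constant, a part that factors over the
removed indices, and `pairing s s`, which is the Vandermonde product of these indices. -/
lemma vandermonde_sub_alpha (N : LatticeA) {i j l : ℤ} (hij : i < j) (hjl : j < l) :
    vandermonde (N - (alpha i + alpha j + alpha l)) =
      pairing N N * (removalUnit N i * removalUnit N j * removalUnit N l) *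
        (diffUnit i j * diffUnit i l * diffUnit j l) := by
  set s := alpha i + alpha j + alpha l with hs
  have sub_left : ∀ n m m' : LatticeA, pairing (n - m) m' = pairing n m' * (pairing m m')⁻¹ := by
    intro n m m'
    rw [eq_mul_inv_iff_mul_eq, ← pairing_add_left, sub_add_cancel]
  have sub_right : ∀ n m m' : LatticeA, pairing n (m - m') = pairing n m * (pairing n m')⁻¹ := by
    intro n m m'
    rw [eq_mul_inv_iff_mul_eq, ← pairing_add_right, sub_add_cancel]
  have hss : pairing s s = diffUnit i j * diffUnit i l * diffUnit j l := by
    simp only [hs, pairing_add_left, pairing_add_right, pairing_alpha hij, pairing_alpha hjl,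
      pairing_alpha (hij.trans hjl), pairing_alpha_of_le le_rfl, pairing_alpha_of_le hij.le,
      pairing_alpha_of_le hjl.le, pairing_alpha_of_le (hij.trans hjl).le]
    simp only [one_mul, mul_one, mul_assoc]
  rw [vandermonde_eq_pairing, sub_left, sub_right, sub_right, ← hss]
  have key : ∀ {G : Type} [CommGroup G] (a x y z x' y' z' b : G),
      a * (x * y * z)⁻¹ * (x' * y' * z' * b⁻¹)⁻¹ =
        a * ((x * x')⁻¹ * (y * y')⁻¹ * (z * z')⁻¹) * b := by
    intro G _ a x y z x' y' z' b
    simp only [mul_inv, inv_inv]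
    simp only [mul_comm, mul_assoc, mul_left_comm]
  have h1 : pairing N s = pairing N (alpha i) * pairing N (alpha j) * pairing N (alpha l) := by
    simp only [hs, pairing_add_right]
  have h2 : pairing s N = pairing (alpha i) N * pairing (alpha j) N * pairing (alpha l) N := by
    simp only [hs, pairing_add_left]
  rw [h1, h2]
  exact key (G := XTLocˣ) _ _ _ _ _ _ _ _

/-- The values `H^{N - α_i - α_j - α_l}`, extended to an alternating function of `i, j, l`. -/
def fayCoord (v : YoungDiagram → ℂ) (N : LatticeA) (i j l : ℤ) : XTLoc :=
  ((pairing N N * (removalUnit N i * removalUnit N j * removalUnit N l) : XTLocˣ) : XTLoc) *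
    algebraMap XTSeries XTLoc ((xVar i - xVar j) * (xVar i - xVar l) * (xVar j - xVar l) *
      latticeTau v (N - (alpha i + alpha j + alpha l)))

lemma latticeEval_eq_fayCoord (v : YoungDiagram → ℂ) {n N : LatticeA} {i j l : ℤ} (hij : i < j)
    (hjl : j < l) (hn : n = N - (alpha i + alpha j + alpha l)) :
    latticeEval v n = fayCoord v N i j l := by
  subst hn
  rw [latticeEval, vandermonde_sub_alpha N hij hjl, fayCoord, latticeTau]
  simp only [map_mul, Units.val_mul, coe_diffUnit hij.ne, coe_diffUnit hjl.ne,
    coe_diffUnit (hij.trans hjl).ne]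
  ring

/-- Each term of the relation involves every one of a, b, p, q, r, s once, so the removal units
factor out. What remains is the Fay identity times x_a - x_b. -/
lemma IsPluckerPoint.isPlucker₃_fayCoord {v : YoungDiagram → ℂ} (hv : IsPluckerPoint v)
    (N : LatticeA) : IsPlucker₃ (fayCoord v N) where
  swap₁₂ i j l := by
    rw [fayCoord, fayCoord, add_comm (alpha i) (alpha j)]
    simp only [map_mul, map_sub, Units.val_mul]
    ring
  swap₂₃ i j l := by
    rw [fayCoord, fayCoord, add_right_comm]
    simp only [map_mul, map_sub, Units.val_mul]
    ring
  self₂₃ i j := by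
    rw [fayCoord, sub_self, mul_zero, zero_mul, map_zero, mul_zero]
  rel a b p q r s := by
    have h := congrArg (algebraMap XTSeries XTLoc) (fay_latticeTau hv N a b p q r s)
    simp only [map_add, map_sub, map_mul, map_zero] at h
    simp only [fayCoord, map_mul, map_sub, Units.val_mul]
    linear_combination ((pairing N N : XTLoc) ^ 2 * removalUnit N a * removalUnit N b *
      removalUnit N p * removalUnit N q * removalUnit N r * removalUnit N s *
      (algebraMap XTSeries XTLoc (xVar a) - algebraMap XTSeries XTLoc (xVar b))) * h

/-! ### The sign-twisted evaluations -/

open Classical in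
lemma units_neg_one_zpow {R : Type*} [Ring R] (e : ℤ) :
    (((-1 : Rˣ) ^ e : Rˣ) : R) = if Even e then 1 else -1 := by
  split_ifs with h
  · rw [h.neg_one_zpow, Units.val_one]
  · rw [(Int.not_even_iff_odd.1 h).neg_one_zpow, Units.val_neg, Units.val_one]

open Classical in
lemma negOnePow_eq (e : ℤ) : negOnePow e = if Even e then 1 else -1 := units_neg_one_zpow e

lemma betaCoord_add (i : ℕ+) (n m : latticeB3) :
    betaCoord i (n + m) = betaCoord i n + betaCoord i m := rfl

lemma betaCoord_one_b₁ : betaCoord 1 b₁ = 1 := by simp [betaCoord, b₁, beta, alpha]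
lemma betaCoord_two_b₁ : betaCoord 2 b₁ = 0 := by simp [betaCoord, b₁, beta, alpha]
lemma betaCoord_three_b₁ : betaCoord 3 b₁ = 0 := by simp [betaCoord, b₁, beta, alpha]
lemma betaCoord_one_b₂ : betaCoord 1 b₂ = 0 := by simp [betaCoord, b₂, beta, alpha]
lemma betaCoord_two_b₂ : betaCoord 2 b₂ = 1 := by simp [betaCoord, b₂, beta, alpha]
lemma betaCoord_three_b₂ : betaCoord 3 b₂ = 0 := by simp [betaCoord, b₂, beta, alpha]
lemma betaCoord_one_b₃ : betaCoord 1 b₃ = 0 := by simp [betaCoord, b₃, beta, alpha]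
lemma betaCoord_two_b₃ : betaCoord 2 b₃ = 0 := by simp [betaCoord, b₃, beta, alpha]
lemma betaCoord_three_b₃ : betaCoord 3 b₃ = 1 := by simp [betaCoord, b₃, beta, alpha]

lemma coe_b₁ : (b₁ : LatticeA) = alpha 0 - alpha (-1) := rfl
lemma coe_b₂ : (b₂ : LatticeA) = alpha 1 - alpha (-2) := rfl
lemma coe_b₃ : (b₃ : LatticeA) = alpha 2 - alpha (-3) := rfl

lemma latticeEvalFrob_single (v : YoungDiagram → ℂ) (n : LatticeA) (a b : ℕ) :
    latticeEvalFrob v n ![a] ![b] = latticeEval v (n + alpha a - alpha (-(b : ℤ) - 1)) := by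
  simp [latticeEvalFrob]

end

end KPLattice

/-! ### Assembly of the doubled hexahedron recurrence -/

open KPLattice in
theorem mainTheorem7 (w : ℙ ℂ (YoungDiagram → ℂ)) (hw : w ∈ KPLattice.infiniteGrassmannian)
    (v : YoungDiagram → ℂ) (hv : v ≠ 0) (hvw : Projectivization.mk ℂ v hv = w) :
    KPLattice.IsDoubledHexahedronSolution (KPLattice.checkH v)
      (KPLattice.checkX v) (KPLattice.checkY v) (KPLattice.checkZ v)
      (KPLattice.checkNegX v) (KPLattice.checkNegY v) (KPLattice.checkNegZ v) := by
  intro n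
  have hp : IsPluckerPoint v := hw v hv hvw
  -- All evaluation points become N minus three of the α's: (p|q) replaces the index p by -q - 1 in
  -- the triple {0, 1, 2}.
  set N : LatticeA := n + (alpha 0 + alpha 1 + alpha 2) with hN
  obtain ⟨r1, r2, r3, r4, r5, r6, r7⟩ := (hp.isPlucker₃_fayCoord N).hexahedron
  have eval : ∀ (i j l : ℤ) {m : LatticeA}, i < j → j < l →
      m = N - (alpha i + alpha j + alpha l) → latticeEval v m = fayCoord v N i j l :=
    fun i j l _ hij hjl hm => latticeEval_eq_fayCoord v hij hjl hm
  have hH : latticeEval v n = fayCoord v N 0 1 2 ∧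
      latticeEval v (n + b₁) = fayCoord v N (-1) 1 2 ∧
      latticeEval v (n + b₂) = fayCoord v N (-2) 0 2 ∧
      latticeEval v (n + b₃) = fayCoord v N (-3) 0 1 ∧
      latticeEval v (n + (b₁ + b₂)) = fayCoord v N (-2) (-1) 2 ∧
      latticeEval v (n + (b₁ + b₃)) = fayCoord v N (-3) (-1) 1 ∧
      latticeEval v (n + (b₂ + b₃)) = fayCoord v N (-3) (-2) 0 ∧
      latticeEval v (n + (b₁ + b₂ + b₃)) = fayCoord v N (-3) (-2) (-1) := by
    refine ⟨?_, ?_, ?_, ?_, ?_, ?_, ?_, ?_⟩ <;>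
      refine eval _ _ _ (by norm_num) (by norm_num) ?_ <;>
      simp only [hN, coe_b₁, coe_b₂, coe_b₃] <;> abel
  have hF : latticeEvalFrob v n ![1] ![2] = fayCoord v N (-3) 0 2 ∧
      latticeEvalFrob v n ![2] ![0] = fayCoord v N (-1) 0 1 ∧
      latticeEvalFrob v n ![0] ![1] = fayCoord v N (-2) 1 2 ∧
      latticeEvalFrob v n ![2] ![1] = fayCoord v N (-2) 0 1 ∧
      latticeEvalFrob v n ![0] ![2] = fayCoord v N (-3) 1 2 ∧
      latticeEvalFrob v n ![1] ![0] = fayCoord v N (-1) 0 2 ∧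
      latticeEvalFrob v (n + b₁) ![2] ![1] = fayCoord v N (-2) (-1) 1 ∧
      latticeEvalFrob v (n + b₂) ![0] ![2] = fayCoord v N (-3) (-2) 2 ∧
      latticeEvalFrob v (n + b₃) ![1] ![0] = fayCoord v N (-3) (-1) 0 ∧
      latticeEvalFrob v (n + b₁) ![1] ![2] = fayCoord v N (-3) (-1) 2 ∧
      latticeEvalFrob v (n + b₂) ![2] ![0] = fayCoord v N (-2) (-1) 0 ∧
      latticeEvalFrob v (n + b₃) ![0] ![1] = fayCoord v N (-3) (-2) 1 := by
    simp only [latticeEvalFrob_single]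
    refine ⟨?_, ?_, ?_, ?_, ?_, ?_, ?_, ?_, ?_, ?_, ?_, ?_⟩ <;>
      refine eval _ _ _ (by norm_num) (by norm_num) ?_ <;>
      simp only [hN, coe_b₁, coe_b₂, coe_b₃] <;> norm_num <;> abel
  obtain ⟨h0, h1, h2, h3, h4, h5, h6, h7⟩ := hH
  obtain ⟨f0, f1, f2, f3, f4, f5, f6, f7, f8, f9, f10, f11⟩ := hF
  simp only [checkH, checkX, checkY, checkZ, checkNegX, checkNegY, checkNegZ, signX, signY, signZ,
    AddSubgroup.coe_add, betaCoord_add, betaCoord_one_b₁, betaCoord_two_b₁, betaCoord_three_b₁,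
    betaCoord_one_b₂, betaCoord_two_b₂, betaCoord_three_b₂, betaCoord_one_b₃, betaCoord_two_b₃, betaCoord_three_b₃,
    h0, h1, h2, h3, h4, h5, h6, h7, f0, f1, f2, f3, f4, f5, f6, f7, f8, f9, f10, f11,
    negOnePow_eq, Int.even_add, Int.even_mul, Int.even_pow, Int.not_even_one]
  -- The twisting signs depend only on the parities of the three coordinates. In each of the eight
  -- cases the first six identities match up to a global sign, the seventh exactly.
  by_cases p1 : Even (betaCoord 1 n) <;> by_cases p2 : Even (betaCoord 2 n) <;>
    by_cases p3 : Even (betaCoord 3 n) <;>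
    simp only [p1, p2, p3, Even.zero, iff_true, iff_false, and_true, not_true, not_false_iff,
      or_true, or_false, ne_eq, ite_true, ite_false, OfNat.ofNat_ne_zero]
  all_goals
    refine ⟨?_, ?_, ?_, ?_, ?_, ?_, ?_⟩
    · first | linear_combination r1 | linear_combination -r1
    · first | linear_combination r2 | linear_combination -r2
    · first | linear_combination r3 | linear_combination -r3
    · first | linear_combination r4 | linear_combination -r4
    · first | linear_combination r5 | linear_combination -r5
    · first | linear_combination r6 | linear_combination -r6
    · linear_combination r7
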